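/- Let $G=SL(2,\mathbb R)\ltimes\mathbb R^{(1,2)}$ with multiplication $(g,\alpha)*(h,\beta)=(gh,\ \alpha\,{}^th^{-1}+\beta)$, where $\mathbb R^{(1,2)}$ is the group of real $1\times2$ matrices. Let $\mathbb H$ be the upper half plane, and let $G$ act on $\mathbb H\times\mathbb C$ by $$(g,\alpha)\circ(\tau,z)=\bigl((d\tau-c)(-b\tau+a)^{-1},\ (z+\alpha_1\tau+\alpha_2)(-b\tau+a)^{-1}\bigr),\qquad g=\begin{pmatrix}a&b\\c&d\end{pmatrix},\ \alpha=(\alpha_1,\alpha_2).$$ Write $\tau=x+iy$, $z=u+iv$ with $x,y,u,v$ real. A differential operator on $\mathbb H\times\mathbb C$ is a $\mathbb C$-linear map $A$ of $C^\infty(\mathbb H\times\mathbb C)$ (smooth complex valued functions) to itself which, near every point, is a finite sum of partial derivatives in $x,y,u,v$ with smooth coefficients. It is invariant if $A(f\circ\gamma)=(Af)\circ\gamma$ for all $\gamma\in G$ and $f\in C^\infty(\mathbb H\times\mathbb C)$. Let $\mathbb D(\mathbb H\times\mathbb C)$ be the set of all invariant differential operators. **Theorem 2.3.** $\mathbb D(\mathbb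 H\times\mathbb C)$ is exactly the (unital) $\mathbb C$-algebra generated, under composition, by $$D=y^2\Bigl(\frac{\partial^2}{\partial x^2}+\frac{\partial^2}{\partial y^2}\Bigr)+v^2\Bigl(\frac{\partial^2}{\partial u^2}+\frac{\partial^2}{\partial v^2}\Bigr)+2yv\Bigl(\frac{\partial^2}{\partial x\partial u}+\frac{\partial^2}{\partial y\partial v}\Bigr),\qquad \Psi=y\Bigl(\frac{\partial^2}{\partial u^2}+\frac{\partial^2}{\partial v^2}\Bigr),$$ $$D_1=2y^2\frac{\partial^3}{\partial x\partial u\partial v}-y^2\frac{\partial}{\partial y}\Bigl(\frac{\partial^2}{\partial u^2}-\frac{\partial^2}{\partial v^2}\Bigr)+\Bigl(v\frac{\partial}{\partial v}+1\Bigr)\Psi,$$ $$D_2=y^2\frac{\partial}{\partial x}\Bigl(\frac{\partial^2}{\partial v^2}-\frac{\partial^2}{\partial u^2}\Bigr)-2y^2\frac{\partial^3}{\partial y\partial u\partial v}-v\frac{\partial}{\partial u}\Psi.$$ Moreover $$[D,\Psi]=D\Psi-\Psi D=2y^2\frac{\partial}{\partial y}\Bigl(\frac{\partial^2}{\partial u^2}-\frac{\partial^2}{\partial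 v^2}\Bigr)-4y^2\frac{\partial^3}{\partial x\partial u\partial v}-2\Bigl(v\frac{\partial}{\partial v}\Psi+\Psi\Bigr)\neq0.$$ In particular $\mathbb D(\mathbb H\times\mathbb C)$ is not commutative. Moreover, the homogeneous space $\mathbb H\times\mathbb C$ of $G$ is not weakly symmetric in the sense of Selberg: there are no $G$-invariant smooth Riemannian metric on $\mathbb H\times\mathbb C$ and isometry $\mu$ of it such that, as groups of transformations, $\mu G\mu^{-1}=G$ and $\mu^2\in G$, and such that for all $p,q\in\mathbb H\times\mathbb C$ some $\gamma\in G$ satisfies $\gamma\circ p=\mu(q)$ and $\gamma\circ q=\mu(p)$. -/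

import Mathlib

open scoped Manifold ContDiff MatrixGroups UpperHalfPlane Matrix

noncomputable section

namespace MaassJacobi

/-! ### The group `SL(2,ℝ) ⋉ ℝ^(1,2)` and its action on `ℍ × ℂ` -/

/-- The underlying set of `SL(2,ℝ) ⋉ ℝ^(1,2)`: pairs `(g, α)` of a matrix in `SL(2,ℝ)` and a
real `1 × 2` matrix. -/
@[ext]
structure JacobiGroup where
  mat : SL(2, ℝ)
  vec : Matrix (Fin 1) (Fin 2) ℝ

namespace JacobiGroup

/-- `(g, α) * (h, β) = (g h, α ᵗh⁻¹ + β)`. -/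
instance : Mul JacobiGroup where
  mul p q := ⟨p.mat * q.mat,
    p.vec * ((q.mat⁻¹ : SL(2, ℝ)) : Matrix (Fin 2) (Fin 2) ℝ)ᵀ + q.vec⟩

instance : One JacobiGroup where
  one := ⟨1, 0⟩

instance : Inv JacobiGroup where
  inv p := ⟨p.mat⁻¹, -(p.vec * (p.mat : Matrix (Fin 2) (Fin 2) ℝ)ᵀ)⟩

theorem mul_def (p q : JacobiGroup) : p * q = ⟨p.mat * q.mat,
    p.vec * ((q.mat⁻¹ : SL(2, ℝ)) : Matrix (Fin 2) (Fin 2) ℝ)ᵀ + q.vec⟩ := rfl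

theorem one_def : (1 : JacobiGroup) = ⟨1, 0⟩ := rfl

theorem inv_def (p : JacobiGroup) :
    p⁻¹ = ⟨p.mat⁻¹, -(p.vec * (p.mat : Matrix (Fin 2) (Fin 2) ℝ)ᵀ)⟩ := rfl

instance : Group JacobiGroup :=
  Group.ofLeftAxioms
    (fun p q r => by
      simp only [mul_def, mul_assoc, mul_inv_rev, Matrix.SpecialLinearGroup.coe_mul,
        Matrix.transpose_mul, Matrix.add_mul, Matrix.mul_assoc, add_assoc])
    (fun p => by simp [mul_def, one_def])
    (fun p => by
      simp only [mul_def, one_def, inv_def, inv_mul_cancel, JacobiGroup.mk.injEq, true_and,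
        Matrix.neg_mul, Matrix.mul_assoc, ← Matrix.transpose_mul,
        ← Matrix.SpecialLinearGroup.coe_mul]
      simp)

/-- The automorphy factor `-b τ + a` of `(g, α)`, where `g = (a b; c d)`. -/
def factor (p : JacobiGroup) (τ : ℂ) : ℂ := -(p.mat 0 1 : ℂ) * τ + (p.mat 0 0 : ℂ)

theorem det_eq (p : JacobiGroup) : p.mat 0 0 * p.mat 1 1 - p.mat 0 1 * p.mat 1 0 = 1 := by
  have h := p.mat.det_coe
  rwa [Matrix.det_fin_two] at h

theorem factor_ne_zero (p : JacobiGroup) {τ : ℂ} (hτ : 0 < τ.im) : p.factor τ ≠ 0 := by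
  intro h
  have h1 := congrArg Complex.im h
  have h2 := congrArg Complex.re h
  have hd := p.det_eq
  simp [factor] at h1 h2
  rcases h1 with h1 | h1
  · simp [h1] at h2 hd
    simp [h2] at hd
  · exact hτ.ne' h1

theorem im_pos (p : JacobiGroup) {τ : ℂ} (hτ : 0 < τ.im) :
    0 < (((p.mat 1 1 : ℂ) * τ - (p.mat 1 0 : ℂ)) / p.factor τ).im := by
  have hN : 0 < Complex.normSq (p.factor τ) := Complex.normSq_pos.2 (p.factor_ne_zero hτ)
  have hd := p.det_eq
  have key : (((p.mat 1 1 : ℂ) * τ - (p.mat 1 0 : ℂ)) / p.factor τ).im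
      = τ.im / Complex.normSq (p.factor τ) := by
    rw [Complex.div_im, ← sub_div]
    congr 1
    simp [factor]
    linear_combination τ.im * hd
  rw [key]
  positivity

/-- `(g, α) ∘ (τ, z) = ((d τ - c) (-b τ + a)⁻¹, (z + α₁ τ + α₂) (-b τ + a)⁻¹)`. -/
instance : SMul JacobiGroup (ℍ × ℂ) where
  smul p q :=
    (⟨((p.mat 1 1 : ℂ) * q.1 - (p.mat 1 0 : ℂ)) / p.factor q.1, p.im_pos q.1.im_pos⟩,
      (q.2 + (p.vec 0 0 : ℂ) * q.1 + (p.vec 0 1 : ℂ)) / p.factor q.1)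

theorem smul_def (p : JacobiGroup) (q : ℍ × ℂ) : p • q =
    (⟨((p.mat 1 1 : ℂ) * q.1 - (p.mat 1 0 : ℂ)) / p.factor q.1, p.im_pos q.1.im_pos⟩,
      (q.2 + (p.vec 0 0 : ℂ) * q.1 + (p.vec 0 1 : ℂ)) / p.factor q.1) := rfl

theorem smul_fst (p : JacobiGroup) (q : ℍ × ℂ) : ((p • q).1 : ℂ) =
    ((p.mat 1 1 : ℂ) * q.1 - (p.mat 1 0 : ℂ)) / p.factor q.1 := rfl

theorem smul_snd (p : JacobiGroup) (q : ℍ × ℂ) : (p • q).2 =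
    (q.2 + (p.vec 0 0 : ℂ) * q.1 + (p.vec 0 1 : ℂ)) / p.factor q.1 := rfl

theorem factor_mul (p q : JacobiGroup) {τ : ℂ} (hτ : 0 < τ.im) : (p * q).factor τ =
    p.factor (((q.mat 1 1 : ℂ) * τ - (q.mat 1 0 : ℂ)) / q.factor τ) * q.factor τ := by
  have h := q.factor_ne_zero hτ
  have e : p.factor (((q.mat 1 1 : ℂ) * τ - (q.mat 1 0 : ℂ)) / q.factor τ) * q.factor τ =
      -(p.mat 0 1 : ℂ) * ((q.mat 1 1 : ℂ) * τ - (q.mat 1 0 : ℂ))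
        + (p.mat 0 0 : ℂ) * q.factor τ := by
    rw [factor, add_mul, mul_assoc, div_mul_cancel₀ _ h]
  rw [e]
  simp [factor, mul_def, Matrix.mul_apply, Fin.sum_univ_two]
  ring

instance : MulAction JacobiGroup (ℍ × ℂ) where
  one_smul q := by
    ext <;> simp [smul_fst, smul_snd, factor, one_def]
  mul_smul p q r := by
    have hq := q.factor_ne_zero r.1.im_pos
    have hp : p.factor ((q • r).1 : ℂ) ≠ 0 := p.factor_ne_zero (q • r).1.im_pos
    have hm : (p * q).factor r.1 = p.factor ((q • r).1 : ℂ) * q.factor r.1 :=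
      p.factor_mul q r.1.im_pos
    refine Prod.ext (UpperHalfPlane.ext ?_) ?_
    · rw [smul_fst, smul_fst p, hm, div_eq_div_iff (mul_ne_zero hp hq) hp, smul_fst q]
      field_simp
      simp [factor, mul_def, Matrix.mul_apply, Fin.sum_univ_two]
      ring
    · rw [smul_snd, smul_snd p, hm, div_eq_div_iff (mul_ne_zero hp hq) hp, smul_snd q, smul_fst q]
      field_simp
      simp [factor, mul_def, Matrix.mul_apply, Fin.sum_univ_two, Matrix.SpecialLinearGroup.coe_inv,
        Matrix.adjugate_fin_two]
      ring

end JacobiGroup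

/-! ### Smooth functions on `ℍ × ℂ` -/

/-- The real smooth manifold structure of the upper half plane (Mathlib has the complex one). -/
instance : IsManifold 𝓘(ℝ, ℂ) ∞ ℍ :=
  UpperHalfPlane.isOpenEmbedding_coe.isManifold_singleton

/-- `f`, read as a function on `ℂ × ℂ` in the global coordinates `(τ, z)`. It is only of interest
on the open set `0 < im τ`. -/
def inCoords (f : ℍ × ℂ → ℂ) : ℂ × ℂ → ℂ :=
  fun q => f (UpperHalfPlane.ofComplex q.1, q.2)

/-- The open subset `{im τ > 0}` of `ℂ × ℂ`, the image of `ℍ × ℂ`. -/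
def domain : Set (ℂ × ℂ) := {q | 0 < q.1.im}

theorem isOpen_domain : IsOpen domain :=
  isOpen_lt continuous_const (Complex.continuous_im.comp continuous_fst)

theorem inCoords_coe (f : ℍ × ℂ → ℂ) (p : ℍ × ℂ) : inCoords f ((p.1 : ℂ), p.2) = f p := by
  simp [inCoords]

theorem contMDiffAt_ofComplex_real {z : ℂ} (hz : 0 < z.im) :
    ContMDiffAt 𝓘(ℝ, ℂ) 𝓘(ℝ, ℂ) ∞ UpperHalfPlane.ofComplex z := by
  rw [contMDiffAt_iff]
  constructor
  · rw [ContinuousAt, nhds_induced, Filter.tendsto_comap_iff]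
    refine Filter.Tendsto.congr' (UpperHalfPlane.eventuallyEq_coe_comp_ofComplex hz).symm ?_
    simpa [UpperHalfPlane.ofComplex_apply_of_im_pos hz] using! Filter.tendsto_id
  · simpa using! contDiffAt_id.congr_of_eventuallyEq
      (UpperHalfPlane.eventuallyEq_coe_comp_ofComplex hz)

/-- Smoothness on the manifold `ℍ × ℂ` is smoothness in the coordinates. -/
theorem contMDiff_iff_inCoords {f : ℍ × ℂ → ℂ} :
    ContMDiff (𝓘(ℝ, ℂ).prod 𝓘(ℝ, ℂ)) 𝓘(ℝ, ℂ) ∞ f ↔ ContDiffOn ℝ ∞ (inCoords f) domain := by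
  constructor
  · intro hf q hq
    have h1 : ContMDiffAt 𝓘(ℝ, ℂ × ℂ) (𝓘(ℝ, ℂ).prod 𝓘(ℝ, ℂ)) ∞
        (fun q : ℂ × ℂ => (UpperHalfPlane.ofComplex q.1, q.2)) q :=
      ((contMDiffAt_ofComplex_real hq).comp q
        (contDiff_fst.contMDiff.contMDiffAt (x := q))).prodMk
        (contDiff_snd.contMDiff.contMDiffAt (x := q))
    have h2 := (hf.contMDiffAt (x := (UpperHalfPlane.ofComplex q.1, q.2))).comp q h1
    exact h2.contDiffAt.contDiffWithinAt
  · intro hf p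
    have h1 : ContMDiffAt (𝓘(ℝ, ℂ).prod 𝓘(ℝ, ℂ)) 𝓘(ℝ, ℂ × ℂ) ∞
        (fun p : ℍ × ℂ => ((p.1 : ℂ), p.2)) p := by
      have hc : ContMDiff 𝓘(ℝ, ℂ) 𝓘(ℝ, ℂ) ∞ ((↑) : ℍ → ℂ) := fun _ => contMDiffAt_extChartAt
      exact (hc.contMDiffAt.comp p contMDiff_fst.contMDiffAt).prodMk_space
        contMDiff_snd.contMDiffAt
    have h2 : ContDiffAt ℝ ∞ (inCoords f) ((p.1 : ℂ), p.2) :=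
      hf.contDiffAt (isOpen_domain.mem_nhds p.1.im_pos)
    have h3 := h2.contMDiffAt.comp p h1
    exact h3.congr_of_eventuallyEq (Filter.Eventually.of_forall fun p => (inCoords_coe f p).symm)

/-- The algebra `C^∞(ℍ × ℂ)` of complex valued functions that are smooth on the real manifold
`ℍ × ℂ`. -/
def SmoothFun : Subalgebra ℂ (ℍ × ℂ → ℂ) where
  carrier := {f | ContMDiff (𝓘(ℝ, ℂ).prod 𝓘(ℝ, ℂ)) 𝓘(ℝ, ℂ) ∞ f}
  mul_mem' {f g} hf hg := by
    simp only [Set.mem_ofPred_eq, contMDiff_iff_inCoords] at *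
    exact hf.mul hg
  add_mem' {f g} hf hg := by
    simp only [Set.mem_ofPred_eq, contMDiff_iff_inCoords] at *
    exact hf.add hg
  algebraMap_mem' _ := contMDiff_const

theorem mem_smoothFun {f : ℍ × ℂ → ℂ} :
    f ∈ SmoothFun ↔ ContDiffOn ℝ ∞ (inCoords f) domain := contMDiff_iff_inCoords

theorem differentiableAt_inCoords (f : SmoothFun) (p : ℍ × ℂ) :
    DifferentiableAt ℝ (inCoords f) ((p.1 : ℂ), p.2) :=
  ((mem_smoothFun.1 f.2).contDiffAt (isOpen_domain.mem_nhds p.1.im_pos)).differentiableAt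
    (by simp)

/-- The constant coefficient vector field in the direction `w ∈ ℂ × ℂ = ℝ⁴`, in the coordinates
`(τ, z)`, as an operator on `C^∞(ℍ × ℂ)`. -/
def dirDeriv (w : ℂ × ℂ) : Module.End ℂ SmoothFun where
  toFun f := ⟨fun p => fderiv ℝ (inCoords f) ((p.1 : ℂ), p.2) w, by
    rw [mem_smoothFun]
    have h : ContDiffOn ℝ ∞ (fun q => fderiv ℝ (inCoords f) q w) domain :=
      ((mem_smoothFun.1 f.2).fderiv_of_isOpen isOpen_domain (by simp)).clm_apply contDiffOn_const
    refine h.congr fun q hq => ?_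
    simp [inCoords, UpperHalfPlane.ofComplex_apply_of_im_pos (show 0 < q.1.im from hq)]⟩
  map_add' f g := by
    ext p
    change fderiv ℝ (inCoords f + inCoords g) _ w = _
    rw [fderiv_add (differentiableAt_inCoords f p) (differentiableAt_inCoords g p)]
    rfl
  map_smul' c f := by
    ext p
    change fderiv ℝ (c • inCoords f) _ w = _
    rw [fderiv_const_smul (differentiableAt_inCoords f p)]
    rfl

/-- Multiplication by a smooth function, as an operator on `C^∞(ℍ × ℂ)`. -/
def mulOp (a : SmoothFun) : Module.End ℂ SmoothFun := LinearMap.mulLeft ℂ a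

/-! With `τ = x + i y`, `z = u + i v`: the operators `∂/∂x`, `∂/∂y`, `∂/∂u`, `∂/∂v`, and the
operators of multiplication by the coordinate functions `y` and `v`. -/

def dx : Module.End ℂ SmoothFun := dirDeriv (1, 0)
def dy : Module.End ℂ SmoothFun := dirDeriv (Complex.I, 0)
def du : Module.End ℂ SmoothFun := dirDeriv (0, 1)
def dv : Module.End ℂ SmoothFun := dirDeriv (0, Complex.I)

def coordY : SmoothFun := ⟨fun p => ((p.1.im : ℝ) : ℂ), by
  rw [mem_smoothFun]
  have h : ContDiffOn ℝ ∞ (fun q : ℂ × ℂ => ((q.1.im : ℝ) : ℂ)) domain :=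
    (Complex.ofRealCLM.contDiff.comp (Complex.imCLM.contDiff.comp contDiff_fst)).contDiffOn
  refine h.congr fun q hq => ?_
  simp [inCoords, UpperHalfPlane.ofComplex_apply_of_im_pos (show 0 < q.1.im from hq)]⟩

def coordV : SmoothFun := ⟨fun p => ((p.2.im : ℝ) : ℂ), by
  rw [mem_smoothFun]
  exact (Complex.ofRealCLM.contDiff.comp (Complex.imCLM.contDiff.comp contDiff_snd)).contDiffOn⟩

def y : Module.End ℂ SmoothFun := mulOp coordY
def v : Module.End ℂ SmoothFun := mulOp coordV

/-! ### Invariant differential operators -/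

/-- `A` is a differential operator: near every point it is a finite sum of partial derivatives
with smooth coefficients. -/
def IsDiffOp (A : Module.End ℂ SmoothFun) : Prop :=
  ∀ p : ℍ × ℂ, ∃ U : Set (ℍ × ℂ), IsOpen U ∧ p ∈ U ∧ ∃ (N : ℕ)
    (a : Fin N → Fin N → Fin N → Fin N → ℍ × ℂ → ℂ),
    (∀ i j k l, ContMDiffOn (𝓘(ℝ, ℂ).prod 𝓘(ℝ, ℂ)) 𝓘(ℝ, ℂ) ∞ (a i j k l) U) ∧
    ∀ f : SmoothFun, ∀ q ∈ U, (A f : ℍ × ℂ → ℂ) q =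
      ∑ i, ∑ j, ∑ k, ∑ l, a i j k l q *
        ((dx ^ (i : ℕ) * dy ^ (j : ℕ) * du ^ (k : ℕ) * dv ^ (l : ℕ)) f : ℍ × ℂ → ℂ) q

/-- The function `p ↦ f (g ∘ p)`. -/
def translate (g : JacobiGroup) : Module.End ℂ SmoothFun where
  toFun f := ⟨fun p => (f : ℍ × ℂ → ℂ) (g • p), by
    rw [mem_smoothFun]
    let F : ℂ × ℂ → ℂ × ℂ := fun q =>
      (((g.mat 1 1 : ℂ) * q.1 - (g.mat 1 0 : ℂ)) / g.factor q.1,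
        (q.2 + (g.vec 0 0 : ℂ) * q.1 + (g.vec 0 1 : ℂ)) / g.factor q.1)
    have h0 : ContDiffOn ℝ ∞ (fun q : ℂ × ℂ => g.factor q.1) domain := by
      unfold JacobiGroup.factor
      fun_prop
    have hF : ContDiffOn ℝ ∞ F domain := by
      have h1 : ContDiffOn ℝ ∞ (fun q : ℂ × ℂ => (g.mat 1 1 : ℂ) * q.1 - (g.mat 1 0 : ℂ))
          domain := by fun_prop
      have h2 : ContDiffOn ℝ ∞ (fun q : ℂ × ℂ => q.2 + (g.vec 0 0 : ℂ) * q.1 + (g.vec 0 1 : ℂ))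
          domain := by fun_prop
      simp only [F, div_eq_mul_inv]
      have h3 := h0.inv (fun q hq => g.factor_ne_zero hq)
      exact (h1.mul h3).prodMk (h2.mul h3)
    have hm : Set.MapsTo F domain domain := fun q hq => g.im_pos hq
    refine ((mem_smoothFun.1 f.2).comp hF hm).congr fun q hq => ?_
    have hq' : 0 < q.1.im := hq
    simp [inCoords, F, JacobiGroup.smul_def, UpperHalfPlane.ofComplex_apply_of_im_pos hq',
      UpperHalfPlane.ofComplex_apply_of_im_pos (g.im_pos hq')]⟩
  map_add' _ _ := rfl
  map_smul' _ _ := rfl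

/-- `A` is invariant under the action of `SL(2,ℝ) ⋉ ℝ^(1,2)`:
`A (f ∘ g) = (A f) ∘ g` for all `g` and `f`. -/
def IsInvariant (A : Module.End ℂ SmoothFun) : Prop :=
  ∀ (g : JacobiGroup) (f : SmoothFun), A (translate g f) = translate g (A f)

/-- `𝔻(ℍ × ℂ)`, the set of all invariant differential operators on `ℍ × ℂ`. -/
def invariantDiffOps : Set (Module.End ℂ SmoothFun) := {A | IsDiffOp A ∧ IsInvariant A}

/-! The four operators. Products are compositions of operators. -/

def opD : Module.End ℂ SmoothFun :=
  y ^ 2 * (dx ^ 2 + dy ^ 2) + v ^ 2 * (du ^ 2 + dv ^ 2) + 2 * y * v * (dx * du + dy * dv)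

def opPsi : Module.End ℂ SmoothFun := y * (du ^ 2 + dv ^ 2)

def opD₁ : Module.End ℂ SmoothFun :=
  2 * y ^ 2 * dx * du * dv - y ^ 2 * dy * (du ^ 2 - dv ^ 2) + (v * dv + 1) * opPsi

def opD₂ : Module.End ℂ SmoothFun :=
  y ^ 2 * dx * (dv ^ 2 - du ^ 2) - 2 * y ^ 2 * dy * du * dv - v * du * opPsi

/-! ### Weakly symmetric spaces in the sense of Selberg -/

section WeaklySymmetric

variable {E : Type*} [NormedAddCommGroup E] [NormedSpace ℝ E]
  {H : Type*} [TopologicalSpace H] (I : ModelWithCorners ℝ E H)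
  {M : Type*} [TopologicalSpace M] [ChartedSpace H M] [IsManifold I ∞ M]

/-- The map `φ` preserves the Riemannian metric `r`. -/
def PreservesMetric
    (r : Bundle.ContMDiffRiemannianMetric I ∞ E (fun p : M => TangentSpace I p))
    (φ : M → M) : Prop :=
  ∀ (p : M) (a b : TangentSpace I p),
    r.inner (φ p) (mfderiv I I φ p a) (mfderiv I I φ p b) = r.inner p a b

/-- The homogeneous space `M` of the group `G` is weakly symmetric in the sense of Selberg: `G`
acts transitively, there is a Riemannian metric on `M` for which `G` acts by isometries, and there
is an isometry `μ` of `M` (not necessarily given by `G`) with `μ G μ⁻¹ = G`, `μ² ∈ G` (as groups of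
transformations of `M`), such that for all `p, q` in `M` some `g` in `G` satisfies `g p = μ q` and
`g q = μ p`. -/
def IsWeaklySymmetric (G : Type*) (M : Type*) [TopologicalSpace M] [ChartedSpace H M]
    [IsManifold I ∞ M] [Group G] [MulAction G M] : Prop :=
  MulAction.IsPretransitive G M ∧
  ∃ r : Bundle.ContMDiffRiemannianMetric I ∞ E (fun p : M => TangentSpace I p),
    (∀ g : G, PreservesMetric I r (fun p => g • p)) ∧
    ∃ μ : Diffeomorph I I M M ∞, PreservesMetric I r μ ∧
      (∀ g : G, ∃ h : G, ∀ p : M, μ (g • μ.symm p) = h • p) ∧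
      (∀ h : G, ∃ g : G, ∀ p : M, μ (g • μ.symm p) = h • p) ∧
      (∃ g : G, ∀ p : M, μ (μ p) = g • p) ∧
      ∀ p q : M, ∃ g : G, g • p = μ q ∧ g • q = μ p

end WeaklySymmetric

end MaassJacobi

end

open MaassJacobi

noncomputable section

namespace MaassJacobi

/-! ### Calculus on `C^∞(ℍ × ℂ)` -/

/-! Write j for the automorphy factor. The complex vector fields `opW`, `opW'`, `opE`, `opE'` form a
frame on which the group acts only through j and its conjugate j̄. An operator of weight (p, q)
picks up j^(-p) j̄^(-q) under translation. The frame fields and multiplication by y shift weights,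
once `opE` and `opE'` are corrected by a scalar that depends on the weight they act on. D, Ψ and two
complex combinations `opP`, `opP'` of Ψ, D₁, D₂ are such products of total weight (0, 0), hence
invariant.

Conversely, the action is transitive, so an invariant operator is determined by its functional at
the base point (i, 0) (`eq_of_atBase_eq`). There a differential operator agrees with a constant
coefficient polynomial in the frame. The frame and 1 span a Lie algebra, so these polynomials are
filtered by degree with commutative associated graded algebra, and the pure weight monomials `mono`
span each filtration step. A rotation of infinite order fixes the base point and acts on a
functional of weight (p, q) by e^(i(q-p)). Invariance therefore leaves only the exponents with 2a +
c = 2b + d (`exists_balanced`). This monoid is generated by (1,1,0,0), (0,0,1,1), (0,1,2,0),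
(1,0,0,2), the leading exponents of D, Ψ, `opP`, `opP'`, and induction on the degree concludes
(`mem_generated_of_isInvariant`).

For weak symmetry, take the real coordinates of z with respect to τ and 1. The group acts on them by
affine maps that do not involve τ, and `pairInvariant` is an invariant of ordered pairs that sees
the τ of the first point only. An isometry that swaps all pairs modulo the group has to interchange
its two arguments. It also normalises the subgroup of translations. Together these would make the
function 1/y constant. -/

theorem smoothFun_ext {f g : SmoothFun} (h : ∀ p, (f : ℍ × ℂ → ℂ) p = (g : ℍ × ℂ → ℂ) p) : f = g :=
  Subtype.ext (funext h)

theorem dirDeriv_apply (w : ℂ × ℂ) (f : SmoothFun) (p : ℍ × ℂ) :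
    (dirDeriv w f : ℍ × ℂ → ℂ) p = fderiv ℝ (inCoords f) ((p.1 : ℂ), p.2) w := rfl

theorem dirDeriv_mul (w : ℂ × ℂ) (f g : SmoothFun) :
    dirDeriv w (f * g) = dirDeriv w f * g + f * dirDeriv w g := by
  refine smoothFun_ext fun p => ?_
  have h := fderiv_mul (differentiableAt_inCoords f p) (differentiableAt_inCoords g p)
  change fderiv ℝ (inCoords f * inCoords g) _ w = _
  rw [h]
  simp only [add_apply, smul_apply, smul_eq_mul,
    inCoords_coe]
  exact (add_comm _ _).trans (congrArg₂ _ (mul_comm _ _) rfl)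

theorem dirDeriv_one (w : ℂ × ℂ) : dirDeriv w 1 = 0 := by
  have h := dirDeriv_mul w 1 1
  simpa using h

theorem dirDeriv_algebraMap (w : ℂ × ℂ) (c : ℂ) :
    dirDeriv w (algebraMap ℂ SmoothFun c) = 0 := by
  rw [Algebra.algebraMap_eq_smul_one, map_smul, dirDeriv_one, smul_zero]

theorem inCoords_dirDeriv (w : ℂ × ℂ) (f : SmoothFun) :
    Set.EqOn (inCoords (dirDeriv w f)) (fun q => fderiv ℝ (inCoords f) q w) domain := by
  intro q hq
  simp [inCoords, dirDeriv, UpperHalfPlane.ofComplex_apply_of_im_pos (show 0 < q.1.im from hq)]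

/-- Symmetry of the second derivative: both sides are values of the second Fréchet derivative in
coordinates, since the inner derivative has its coordinate formula on an open set. -/
theorem dirDeriv_comm (w w' : ℂ × ℂ) (f : SmoothFun) :
    dirDeriv w (dirDeriv w' f) = dirDeriv w' (dirDeriv w f) := by
  refine smoothFun_ext fun p => ?_
  have hp : ((p.1 : ℂ), p.2) ∈ domain := p.1.im_pos
  have hn := isOpen_domain.mem_nhds hp
  have hc : ContDiffAt ℝ ∞ (inCoords f) ((p.1 : ℂ), p.2) := (mem_smoothFun.1 f.2).contDiffAt hn
  have hs : IsSymmSndFDerivAt ℝ (inCoords f) ((p.1 : ℂ), p.2) := hc.isSymmSndFDerivAt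
    (by rw [minSmoothness_of_isRCLikeNormedField]; exact WithTop.coe_le_coe.2 le_top)
  have hd : DifferentiableAt ℝ (fderiv ℝ (inCoords f)) ((p.1 : ℂ), p.2) :=
    (hc.fderiv_right (m := 1) (by exact WithTop.coe_le_coe.2 le_top)).differentiableAt (by simp)
  have key : ∀ w w' : ℂ × ℂ, (dirDeriv w (dirDeriv w' f) : ℍ × ℂ → ℂ) p =
      fderiv ℝ (fderiv ℝ (inCoords f)) ((p.1 : ℂ), p.2) w w' := by
    intro w w'
    rw [dirDeriv_apply, ((inCoords_dirDeriv w' f).eventuallyEq_of_mem hn).fderiv_eq,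
      fderiv_clm_apply hd (by fun_prop)]
    simp
  rw [key, key]
  exact hs w w'

theorem fderiv_inCoords_of_eqOn {f : SmoothFun} {F : ℂ × ℂ → ℂ} (h : Set.EqOn (inCoords f) F domain)
    (p : ℍ × ℂ) : fderiv ℝ (inCoords f) ((p.1 : ℂ), p.2) = fderiv ℝ F ((p.1 : ℂ), p.2) :=
  (h.eventuallyEq_of_mem (isOpen_domain.mem_nhds p.1.im_pos)).fderiv_eq

theorem dirDeriv_coordY (w : ℂ × ℂ) :
    dirDeriv w coordY = algebraMap ℂ SmoothFun (w.1.im : ℂ) := by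
  refine smoothFun_ext fun p => ?_
  have h : Set.EqOn (inCoords coordY)
      (Complex.ofRealCLM.comp (Complex.imCLM.comp (ContinuousLinearMap.fst ℝ ℂ ℂ))) domain := by
    intro q hq
    simp [inCoords, coordY, UpperHalfPlane.ofComplex_apply_of_im_pos (show 0 < q.1.im from hq)]
  rw [dirDeriv_apply, fderiv_inCoords_of_eqOn h, ContinuousLinearMap.fderiv]
  rfl

theorem dirDeriv_coordV (w : ℂ × ℂ) :
    dirDeriv w coordV = algebraMap ℂ SmoothFun (w.2.im : ℂ) := by
  refine smoothFun_ext fun p => ?_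
  have h : Set.EqOn (inCoords coordV)
      (Complex.ofRealCLM.comp (Complex.imCLM.comp (ContinuousLinearMap.snd ℝ ℂ ℂ))) domain := by
    intro q hq
    simp [inCoords, coordV]
  rw [dirDeriv_apply, fderiv_inCoords_of_eqOn h, ContinuousLinearMap.fderiv]
  rfl

theorem dirDeriv_eq (w : ℂ × ℂ) (f : SmoothFun) (p : ℍ × ℂ) :
    fderiv ℝ (inCoords f) ((p.1 : ℂ), p.2) w =
      w.1.re * (dx f : ℍ × ℂ → ℂ) p + w.1.im * (dy f : ℍ × ℂ → ℂ) p
        + w.2.re * (du f : ℍ × ℂ → ℂ) p + w.2.im * (dv f : ℍ × ℂ → ℂ) p := by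
  have hw : w = w.1.re • ((1, 0) : ℂ × ℂ) + w.1.im • ((Complex.I, 0) : ℂ × ℂ)
      + w.2.re • ((0, 1) : ℂ × ℂ) + w.2.im • ((0, Complex.I) : ℂ × ℂ) := by
    ext <;> simp
  conv_lhs => rw [hw]
  simp only [map_add, map_smul, dx, dy, du, dv, dirDeriv_apply, Complex.real_smul]

/-- The inverse of a nowhere vanishing smooth function. -/
def smoothInv (f : SmoothFun) (hf : ∀ p, (f : ℍ × ℂ → ℂ) p ≠ 0) : SmoothFun :=
  ⟨fun p => ((f : ℍ × ℂ → ℂ) p)⁻¹, by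
    rw [mem_smoothFun]
    exact (mem_smoothFun.1 f.2).inv fun q _ => hf _⟩

/-- A nowhere vanishing smooth function as a unit of `C^∞(ℍ × ℂ)`. -/
def smoothUnit (f : SmoothFun) (hf : ∀ p, (f : ℍ × ℂ → ℂ) p ≠ 0) : SmoothFunˣ where
  val := f
  inv := smoothInv f hf
  val_inv := smoothFun_ext fun p => mul_inv_cancel₀ (hf p)
  inv_val := smoothFun_ext fun p => inv_mul_cancel₀ (hf p)

theorem coordY_ne_zero (p : ℍ × ℂ) : (coordY : ℍ × ℂ → ℂ) p ≠ 0 := by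
  change ((p.1.im : ℝ) : ℂ) ≠ 0
  exact_mod_cast p.1.im_pos.ne'

/-- The coordinate `y` as a unit. -/
def unitY : SmoothFunˣ := smoothUnit coordY coordY_ne_zero

theorem mulOp_apply (a f : SmoothFun) : mulOp a f = a * f := rfl

/-! Rewriting rules that turn identities of operators into identities in `C^∞(ℍ × ℂ)`. -/

theorem y_apply (f : SmoothFun) : y f = coordY * f := rfl
theorem v_apply (f : SmoothFun) : v f = coordV * f := rfl

theorem dx_mul (f g : SmoothFun) : dx (f * g) = dx f * g + f * dx g := dirDeriv_mul _ f g
theorem dy_mul (f g : SmoothFun) : dy (f * g) = dy f * g + f * dy g := dirDeriv_mul _ f g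
theorem du_mul (f g : SmoothFun) : du (f * g) = du f * g + f * du g := dirDeriv_mul _ f g
theorem dv_mul (f g : SmoothFun) : dv (f * g) = dv f * g + f * dv g := dirDeriv_mul _ f g
theorem dx_const (c : ℂ) : dx (algebraMap ℂ SmoothFun c) = 0 := dirDeriv_algebraMap _ c
theorem dy_const (c : ℂ) : dy (algebraMap ℂ SmoothFun c) = 0 := dirDeriv_algebraMap _ c
theorem du_const (c : ℂ) : du (algebraMap ℂ SmoothFun c) = 0 := dirDeriv_algebraMap _ c
theorem dv_const (c : ℂ) : dv (algebraMap ℂ SmoothFun c) = 0 := dirDeriv_algebraMap _ c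
theorem dx_one : dx 1 = 0 := dirDeriv_one _
theorem dy_one : dy 1 = 0 := dirDeriv_one _
theorem du_one : du 1 = 0 := dirDeriv_one _
theorem dv_one : dv 1 = 0 := dirDeriv_one _
theorem dx_y : dx coordY = 0 := by simp [dx, dirDeriv_coordY]
theorem dy_y : dy coordY = 1 := by simp [dy, dirDeriv_coordY]
theorem du_y : du coordY = 0 := by simp [du, dirDeriv_coordY]
theorem dv_y : dv coordY = 0 := by simp [dv, dirDeriv_coordY]
theorem dx_v : dx coordV = 0 := by simp [dx, dirDeriv_coordV]
theorem dy_v : dy coordV = 0 := by simp [dy, dirDeriv_coordV]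
theorem du_v : du coordV = 0 := by simp [du, dirDeriv_coordV]
theorem dv_v : dv coordV = 1 := by simp [dv, dirDeriv_coordV]
theorem dy_dx (f : SmoothFun) : dy (dx f) = dx (dy f) := dirDeriv_comm _ _ f
theorem du_dx (f : SmoothFun) : du (dx f) = dx (du f) := dirDeriv_comm _ _ f
theorem dv_dx (f : SmoothFun) : dv (dx f) = dx (dv f) := dirDeriv_comm _ _ f
theorem du_dy (f : SmoothFun) : du (dy f) = dy (du f) := dirDeriv_comm _ _ f
theorem dv_dy (f : SmoothFun) : dv (dy f) = dy (dv f) := dirDeriv_comm _ _ f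
theorem dv_du (f : SmoothFun) : dv (du f) = du (dv f) := dirDeriv_comm _ _ f

/-! ### The frame -/

set_option linter.unusedSimpArgs false

/-- The imaginary unit, as a constant function. -/
def imUnit : SmoothFun := algebraMap ℂ SmoothFun Complex.I

theorem imUnit_mul_self : imUnit * imUnit = -1 := by
  rw [imUnit, ← map_mul, Complex.I_mul_I, map_neg, map_one]

/-- Turning the scalar i into a ring element lets `ring` and `linear_combination` work inside the
commutative ring of functions, with i² = -1 as the only extra relation. -/
theorem I_smul (f : SmoothFun) : Complex.I • f = imUnit * f := Algebra.smul_def _ _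

theorem dx_imUnit : dx imUnit = 0 := dx_const _
theorem dy_imUnit : dy imUnit = 0 := dy_const _
theorem du_imUnit : du imUnit = 0 := du_const _
theorem dv_imUnit : dv imUnit = 0 := dv_const _

/-- `2 (y ∂_τ + v ∂_z)` -/
def opE : Module.End ℂ SmoothFun := y * (dx - Complex.I • dy) + v * (du - Complex.I • dv)
/-- `2 (y ∂_τ̄ + v ∂_z̄)` -/
def opE' : Module.End ℂ SmoothFun := y * (dx + Complex.I • dy) + v * (du + Complex.I • dv)
/-- `2 ∂_z` -/
def opW : Module.End ℂ SmoothFun := du - Complex.I • dv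
/-- `2 ∂_z̄` -/
def opW' : Module.End ℂ SmoothFun := du + Complex.I • dv

theorem opE_apply (f : SmoothFun) :
    opE f = coordY * (dx f - imUnit * dy f) + coordV * (du f - imUnit * dv f) := by
  simp [opE, y_apply, v_apply, I_smul]
theorem opE'_apply (f : SmoothFun) :
    opE' f = coordY * (dx f + imUnit * dy f) + coordV * (du f + imUnit * dv f) := by
  simp [opE', y_apply, v_apply, I_smul]
theorem opW_apply (f : SmoothFun) : opW f = du f - imUnit * dv f := by simp [opW, I_smul]
theorem opW'_apply (f : SmoothFun) : opW' f = du f + imUnit * dv f := by simp [opW', I_smul]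

theorem opE_mul (f g : SmoothFun) : opE (f * g) = opE f * g + f * opE g := by
  simp only [opE_apply, dx_mul, dy_mul, du_mul, dv_mul]; ring
theorem opE'_mul (f g : SmoothFun) : opE' (f * g) = opE' f * g + f * opE' g := by
  simp only [opE'_apply, dx_mul, dy_mul, du_mul, dv_mul]; ring
theorem opW_mul (f g : SmoothFun) : opW (f * g) = opW f * g + f * opW g := by
  simp only [opW_apply, du_mul, dv_mul]; ring
theorem opW'_mul (f g : SmoothFun) : opW' (f * g) = opW' f * g + f * opW' g := by
  simp only [opW'_apply, du_mul, dv_mul]; ring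

theorem opE_y : opE coordY = -(imUnit * coordY) := by
  simp only [opE_apply, dx_y, dy_y, du_y, dv_y]; ring
theorem opE'_y : opE' coordY = imUnit * coordY := by
  simp only [opE'_apply, dx_y, dy_y, du_y, dv_y]; ring
theorem opW_y : opW coordY = 0 := by simp [opW_apply, du_y, dv_y]
theorem opW'_y : opW' coordY = 0 := by simp [opW'_apply, du_y, dv_y]

/-- The brackets computed here are combinations of frame fields with constant coefficients. This is
what makes the frame and the identity span a Lie algebra. -/
theorem opE_opW : opE * opW = opW * opE + Complex.I • opW := by
  ext1 f
  simp only [LinearMap.add_apply, Module.End.mul_apply, LinearMap.smul_apply, I_smul, opE_apply,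
    opW_apply, map_add, map_sub, dx_mul, dy_mul, du_mul, dv_mul, dx_y, dy_y, du_y, dv_y, dx_v, dy_v,
    du_v, dv_v, dx_imUnit, dy_imUnit, du_imUnit, dv_imUnit, dy_dx, du_dx, dv_dx, du_dy, dv_dy,
    dv_du]
  ring

theorem opE_opW' : opE * opW' = opW' * opE + (-1 : ℂ) • Complex.I • opW := by
  ext1 f
  simp only [LinearMap.add_apply, neg_one_smul, Module.End.mul_apply, LinearMap.smul_apply,
    I_smul, opE_apply, opW'_apply,
    opW_apply, map_add, map_sub, dx_mul, dy_mul, du_mul, dv_mul, dx_y, dy_y, du_y, dv_y, dx_v, dy_v,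
    du_v, dv_v, dx_imUnit, dy_imUnit, du_imUnit, dv_imUnit, dy_dx, du_dx, dv_dx, du_dy, dv_dy,
    dv_du]
  ring

theorem opE'_opW : opE' * opW = opW * opE' + Complex.I • opW' := by
  ext1 f
  simp only [LinearMap.add_apply, neg_one_smul, Module.End.mul_apply, LinearMap.smul_apply,
    I_smul, opE'_apply, opW'_apply,
    opW_apply, map_add, map_sub, dx_mul, dy_mul, du_mul, dv_mul, dx_y, dy_y, du_y, dv_y, dx_v, dy_v,
    du_v, dv_v, dx_imUnit, dy_imUnit, du_imUnit, dv_imUnit, dy_dx, du_dx, dv_dx, du_dy, dv_dy,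
    dv_du]
  ring

theorem opE'_opW' : opE' * opW' = opW' * opE' + (-1 : ℂ) • Complex.I • opW' := by
  ext1 f
  simp only [LinearMap.add_apply, neg_one_smul, Module.End.mul_apply, LinearMap.smul_apply,
    I_smul, opE'_apply, opW'_apply,
    opW_apply, map_add, map_sub, dx_mul, dy_mul, du_mul, dv_mul, dx_y, dy_y, du_y, dv_y, dx_v, dy_v,
    du_v, dv_v, dx_imUnit, dy_imUnit, du_imUnit, dv_imUnit, dy_dx, du_dx, dv_dx, du_dy, dv_dy,
    dv_du]
  ring

theorem opW_opW' : opW * opW' = opW' * opW := by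
  ext1 f
  simp only [Module.End.mul_apply, opW'_apply,
    opW_apply, map_add, map_sub, du_mul, dv_mul, du_imUnit, dv_imUnit, dv_du]
  ring

theorem opE_opE' : opE * opE' = opE' * opE + (-1 : ℂ) • Complex.I • (opE + opE') := by
  ext1 f
  simp only [LinearMap.add_apply, neg_one_smul, Module.End.mul_apply,
    LinearMap.smul_apply,
    I_smul, opE'_apply, opE_apply,
    opW_apply, map_add, map_sub, dx_mul, dy_mul, du_mul, dv_mul, dx_y, dy_y, du_y, dv_y, dx_v, dy_v,
    du_v, dv_v, dx_imUnit, dy_imUnit, du_imUnit, dv_imUnit, dy_dx, du_dx, dv_dx, du_dy, dv_dy,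
    dv_du]
  ring

/-! ### The generators in terms of the frame -/

/-- The summand i is the weight correction: `opE'` takes weight (0, 0) to (-1, 1), and `opE` acting
on p = -1 is corrected by -ip = i. Invariance of D is then read off the factorisation. -/
theorem opD_eq : opD = (opE + Complex.I • 1) * opE' := by
  ext1 f
  simp only [opD, LinearMap.add_apply, Module.End.mul_apply, y_apply, v_apply, LinearMap.smul_apply,
    Module.End.one_apply, pow_two, two_mul, add_mul,
    I_smul, opE'_apply, opE_apply, map_add, dx_mul, dy_mul, du_mul, dv_mul, dx_y, dy_y, du_y, dv_y,
    dx_v, dy_v, du_v, dv_v, dx_imUnit, dy_imUnit, du_imUnit, dv_imUnit, dy_dx, du_dx, dv_dx, du_dy,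
    dv_dy, dv_du]
  linear_combination (-(coordY * (coordY * dy (dy f) + coordV * dy (dv f)))
    - coordV * (coordY * dy (dv f) + coordV * dv (dv f))) * (-1) * imUnit_mul_self

theorem opPsi_eq : opPsi = y * opW * opW' := by
  ext1 f
  simp only [opPsi, LinearMap.add_apply, Module.End.mul_apply, y_apply, pow_two, opW_apply,
    opW'_apply, map_add, du_mul, dv_mul, du_imUnit, dv_imUnit, dv_du]
  linear_combination coordY * dv (dv f) * imUnit_mul_self

/-- `8 y² ∂_τ̄ ∂_z² + 8 y v ∂_z̄ ∂_z²` -/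
def opP : Module.End ℂ SmoothFun := y * opE' * opW ^ 2
/-- `8 y² ∂_τ ∂_z̄² + 8 y v ∂_z ∂_z̄²` -/
def opP' : Module.End ℂ SmoothFun := y * opE * opW' ^ 2

theorem opW_opW_apply (f : SmoothFun) :
    opW (opW f) = du (du f) - dv (dv f) - imUnit * (2 * du (dv f)) := by
  simp only [opW_apply, map_sub, du_mul, dv_mul, du_imUnit, dv_imUnit, dv_du]
  linear_combination dv (dv f) * imUnit_mul_self

theorem opW'_opW'_apply (f : SmoothFun) :
    opW' (opW' f) = du (du f) - dv (dv f) + imUnit * (2 * du (dv f)) := by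
  simp only [opW'_apply, map_add, du_mul, dv_mul, du_imUnit, dv_imUnit, dv_du]
  linear_combination dv (dv f) * imUnit_mul_self

/-- Invertible change of generators: modulo Ψ, the operators D₁ and D₂ span the same plane as two
pure weight products. No scalar correction appears in those products, because `opE'` acts on weight
(2, 0), where q = 0. -/
theorem opP_eq : opP = -opD₂ - Complex.I • (opD₁ - opPsi) := by
  ext1 f
  simp only [opP, opD₁, opD₂, opPsi, pow_two, Module.End.mul_apply, opW_opW_apply, opE'_apply,
    LinearMap.sub_apply, LinearMap.neg_apply, LinearMap.add_apply, LinearMap.smul_apply, I_smul,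
    y_apply, v_apply, two_mul, add_mul, Module.End.one_apply, map_add, map_sub, dx_mul, dy_mul,
    du_mul, dv_mul, dx_y, dy_y, du_y, dv_y, dx_v, dy_v, du_v, dv_v, dx_imUnit, dy_imUnit, du_imUnit,
    dv_imUnit, dy_dx, du_dx, dv_dx, du_dy, dv_dy, dv_du]
  linear_combination coordY * (-2) *
    (coordY * dy (du (dv f)) + coordV * du (dv (dv f))) * imUnit_mul_self

theorem opP'_eq : opP' = -opD₂ + Complex.I • (opD₁ - opPsi) := by
  ext1 f
  simp only [opP', opD₁, opD₂, opPsi, pow_two, Module.End.mul_apply, opW'_opW'_apply, opE_apply,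
    LinearMap.sub_apply, LinearMap.neg_apply, LinearMap.add_apply, LinearMap.smul_apply, I_smul,
    y_apply, v_apply, two_mul, add_mul, Module.End.one_apply, map_add, map_sub, dx_mul, dy_mul,
    du_mul, dv_mul, dx_y, dy_y, du_y, dv_y, dx_v, dy_v, du_v, dv_v, dx_imUnit, dy_imUnit, du_imUnit,
    dv_imUnit, dy_dx, du_dx, dv_dx, du_dy, dv_dy, dv_du]
  linear_combination coordY * (-2) *
    (coordY * dy (du (dv f)) + coordV * du (dv (dv f))) * imUnit_mul_self

theorem opD₁_eq : opD₁ = opPsi + ((Complex.I / 2) • opP + (-(Complex.I / 2)) • opP') := by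
  rw [opP_eq, opP'_eq]
  match_scalars <;> ring_nf <;> norm_num

theorem opD₂_eq : opD₂ = (-(1 / 2) : ℂ) • (opP + opP') := by
  rw [opP_eq, opP'_eq]
  module

/-! ### The commutator of D and Ψ -/

theorem opD_opPsi_commutator : opD * opPsi - opPsi * opD =
    2 * y ^ 2 * dy * (du ^ 2 - dv ^ 2) - 4 * y ^ 2 * dx * du * dv
      - 2 * (v * dv * opPsi + opPsi) := by
  -- With 4 written as 2 + 2, `two_mul` and `add_mul` resolve the numeral into sums of operators.
  have h4 : (4 : Module.End ℂ SmoothFun) = 2 + 2 := by norm_num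
  rw [h4]
  ext1 f
  simp only [opD, opPsi, pow_two, Module.End.mul_apply,
    LinearMap.sub_apply, LinearMap.neg_apply, LinearMap.add_apply, LinearMap.smul_apply, I_smul,
    y_apply, v_apply, two_mul, add_mul, Module.End.one_apply, map_add, map_sub, dx_mul, dy_mul,
    du_mul, dv_mul, dx_y, dy_y, du_y, dv_y, dx_v, dy_v, du_v, dv_v, map_zero, map_one,
    dx_one, dy_one, du_one, dv_one,
    dy_dx, du_dx, dv_dx, du_dy, dv_dy, dv_du]
  ring

theorem opD_opPsi_commutator_ne_zero : opD * opPsi - opPsi * opD ≠ 0 := by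
  have h4 : (4 : Module.End ℂ SmoothFun) = 2 + 2 := by norm_num
  intro h
  rw [opD_opPsi_commutator, h4] at h
  -- On v² only the term -2Ψ survives, and it gives -4y.
  have h1 := LinearMap.congr_fun h (coordV * coordV)
  simp only [opD, opPsi, pow_two, Module.End.mul_apply,
    LinearMap.sub_apply, LinearMap.neg_apply, LinearMap.add_apply, LinearMap.smul_apply, I_smul,
    y_apply, v_apply, two_mul, add_mul, Module.End.one_apply, map_add, map_sub, dx_mul, dy_mul,
    du_mul, dv_mul, dx_y, dy_y, du_y, dv_y, dx_v, dy_v, du_v, dv_v, map_zero, map_one,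
    dx_one, dy_one, du_one, dv_one, LinearMap.zero_apply] at h1
  have h2 : coordY = 0 := by
    have : (-4 : ℂ) • coordY = 0 := by
      rw [Algebra.smul_def, map_neg]
      simp only [map_ofNat]
      linear_combination h1
    simpa using this
  apply coordY_ne_zero (UpperHalfPlane.I, 0)
  rw [h2]
  rfl

/-! ### Translations -/

theorem translate_apply (g : JacobiGroup) (f : SmoothFun) (p : ℍ × ℂ) :
    (translate g f : ℍ × ℂ → ℂ) p = (f : ℍ × ℂ → ℂ) (g • p) := rfl

theorem translate_map_mul (g : JacobiGroup) (a b : SmoothFun) :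
    translate g (a * b) = translate g a * translate g b := rfl

/-- The action is holomorphic, so the derivative is computed over ℂ and restricted to ℝ at the end.
The first component simplifies to w₁/j² because det g = 1. -/
theorem hasFDerivAt_smul (g : JacobiGroup) {q : ℂ × ℂ} (hq : q ∈ domain) (w : ℂ × ℂ) :
    ∃ L : ℂ × ℂ →L[ℝ] ℂ × ℂ, HasFDerivAt (fun q : ℂ × ℂ =>
      (((g.mat 1 1 : ℂ) * q.1 - (g.mat 1 0 : ℂ)) / g.factor q.1,
        (q.2 + (g.vec 0 0 : ℂ) * q.1 + (g.vec 0 1 : ℂ)) / g.factor q.1)) L q ∧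
      L w = (w.1 / g.factor q.1 ^ 2, (w.2 + (g.vec 0 0 : ℂ) * w.1) / g.factor q.1
        + (g.mat 0 1 : ℂ) * (q.2 + (g.vec 0 0 : ℂ) * q.1 + (g.vec 0 1 : ℂ)) * w.1
          / g.factor q.1 ^ 2) := by
  have hj := g.factor_ne_zero hq
  have h1 : HasFDerivAt (fun q : ℂ × ℂ => q.1) (ContinuousLinearMap.fst ℂ ℂ ℂ) q := hasFDerivAt_fst
  have h2 : HasFDerivAt (fun q : ℂ × ℂ => q.2) (ContinuousLinearMap.snd ℂ ℂ ℂ) q := hasFDerivAt_snd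
  have hF : HasFDerivAt (fun q : ℂ × ℂ => g.factor q.1) _ q :=
    (h1.const_mul (-(g.mat 0 1 : ℂ))).add_const (g.mat 0 0 : ℂ)
  have hI := (hasDerivAt_inv hj).comp_hasFDerivAt q hF
  have hA := ((h1.const_mul (g.mat 1 1 : ℂ)).sub_const (g.mat 1 0 : ℂ)).mul hI
  have hB := ((h2.add (h1.const_mul (g.vec 0 0 : ℂ))).add_const (g.vec 0 1 : ℂ)).mul hI
  refine ⟨_, (hA.prodMk hB).restrictScalars ℝ, ?_⟩
  have hd : (g.mat 0 0 : ℂ) * g.mat 1 1 - g.mat 0 1 * g.mat 1 0 = 1 := by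
    exact_mod_cast g.det_eq
  ext1
  · simp
    field_simp
    simp [JacobiGroup.factor]
    linear_combination w.1 * hd
  · simp
    field_simp
    ring

theorem dirDeriv_translate (w : ℂ × ℂ) (g : JacobiGroup) (f : SmoothFun) (p : ℍ × ℂ) :
    (dirDeriv w (translate g f) : ℍ × ℂ → ℂ) p =
      fderiv ℝ (inCoords f) (((g • p).1 : ℂ), (g • p).2)
        (w.1 / g.factor p.1 ^ 2, (w.2 + (g.vec 0 0 : ℂ) * w.1) / g.factor p.1
        + (g.mat 0 1 : ℂ) * (p.2 + (g.vec 0 0 : ℂ) * p.1 + (g.vec 0 1 : ℂ)) * w.1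
          / g.factor p.1 ^ 2) := by
  have hp : ((p.1 : ℂ), p.2) ∈ domain := p.1.im_pos
  obtain ⟨L, hL, hw⟩ := hasFDerivAt_smul g hp w
  have hE : Set.EqOn (inCoords (translate g f)) (inCoords f ∘ fun q : ℂ × ℂ =>
      (((g.mat 1 1 : ℂ) * q.1 - (g.mat 1 0 : ℂ)) / g.factor q.1,
        (q.2 + (g.vec 0 0 : ℂ) * q.1 + (g.vec 0 1 : ℂ)) / g.factor q.1)) domain := by
    intro q hq
    have hq' : 0 < q.1.im := hq
    simp [inCoords, translate, JacobiGroup.smul_def, UpperHalfPlane.ofComplex_apply_of_im_pos hq',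
      UpperHalfPlane.ofComplex_apply_of_im_pos (g.im_pos hq')]
  have hf : HasFDerivAt (inCoords f) _ _ := (differentiableAt_inCoords f (g • p)).hasFDerivAt
  rw [dirDeriv_apply, fderiv_inCoords_of_eqOn hE, (hf.comp ((p.1 : ℂ), p.2) hL).fderiv,
    ContinuousLinearMap.comp_apply, hw]

/-- The automorphy factor, as a function on `ℍ × ℂ`. -/
def factorFun (g : JacobiGroup) : SmoothFun :=
  ⟨fun p => g.factor p.1, by
    rw [mem_smoothFun]
    have h : ContDiffOn ℝ ∞ (fun q : ℂ × ℂ => g.factor q.1) domain := by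
      unfold JacobiGroup.factor
      fun_prop
    refine h.congr fun q hq => ?_
    simp [inCoords, UpperHalfPlane.ofComplex_apply_of_im_pos (show 0 < q.1.im from hq)]⟩

/-- The conjugate of the automorphy factor, as a function on `ℍ × ℂ`. -/
def factorFun' (g : JacobiGroup) : SmoothFun :=
  ⟨fun p => (starRingEnd ℂ) (g.factor p.1), by
    rw [mem_smoothFun]
    exact Complex.conjCLE.contDiff.comp_contDiffOn (mem_smoothFun.1 (factorFun g).2)⟩

/-- The automorphy factor as a unit of `C^∞(ℍ × ℂ)`. -/
def factorUnit (g : JacobiGroup) : SmoothFunˣ :=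
  smoothUnit (factorFun g) fun p => g.factor_ne_zero p.1.im_pos

/-- The conjugate of the automorphy factor as a unit of `C^∞(ℍ × ℂ)`. -/
def factorUnit' (g : JacobiGroup) : SmoothFunˣ :=
  smoothUnit (factorFun' g) fun p => (map_ne_zero _).2 (g.factor_ne_zero p.1.im_pos)

/-! ### Equivariance of the frame -/

-- Splitting the real differential into holomorphic and antiholomorphic parts, which a holomorphic
-- change of variables transforms separately.
open ComplexConjugate in
theorem fderiv_eq_wirtinger (a b : ℂ) (f : SmoothFun) (p : ℍ × ℂ) :
    fderiv ℝ (inCoords f) ((p.1 : ℂ), p.2) (a, b) =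
      (a * ((dx f : ℍ × ℂ → ℂ) p - Complex.I * (dy f : ℍ × ℂ → ℂ) p)
      + conj a * ((dx f : ℍ × ℂ → ℂ) p + Complex.I * (dy f : ℍ × ℂ → ℂ) p)
      + b * ((du f : ℍ × ℂ → ℂ) p - Complex.I * (dv f : ℍ × ℂ → ℂ) p)
      + conj b * ((du f : ℍ × ℂ → ℂ) p + Complex.I * (dv f : ℍ × ℂ → ℂ) p)) / 2 := by
  have ha : conj a = a.re - a.im * Complex.I := by
    apply Complex.ext <;> simp
  have hb : conj b = b.re - b.im * Complex.I := by
    apply Complex.ext <;> simp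
  rw [dirDeriv_eq, ha, hb]
  dsimp only
  linear_combination
    (((dx f : ℍ × ℂ → ℂ) p - Complex.I * (dy f : ℍ × ℂ → ℂ) p) * Complex.re_add_im a
    + ((du f : ℍ × ℂ → ℂ) p - Complex.I * (dv f : ℍ × ℂ → ℂ) p) * Complex.re_add_im b) / 2
    + (a.im * (dy f : ℍ × ℂ → ℂ) p + b.im * (dv f : ℍ × ℂ → ℂ) p) * Complex.I_mul_I

theorem coe_im_eq (z : ℂ) : (z.im : ℂ) = (z - (starRingEnd ℂ) z) / (2 * Complex.I) := by
  rw [Complex.sub_conj]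
  push_cast
  field_simp

theorem opW_apply_apply (f : SmoothFun) (p : ℍ × ℂ) : (opW f : ℍ × ℂ → ℂ) p =
    (du f : ℍ × ℂ → ℂ) p - Complex.I * (dv f : ℍ × ℂ → ℂ) p := rfl
theorem opW'_apply_apply (f : SmoothFun) (p : ℍ × ℂ) : (opW' f : ℍ × ℂ → ℂ) p =
    (du f : ℍ × ℂ → ℂ) p + Complex.I * (dv f : ℍ × ℂ → ℂ) p := rfl
theorem opE_apply_apply (f : SmoothFun) (p : ℍ × ℂ) : (opE f : ℍ × ℂ → ℂ) p =
    p.1.im * ((dx f : ℍ × ℂ → ℂ) p - Complex.I * (dy f : ℍ × ℂ → ℂ) p)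
      + p.2.im * ((du f : ℍ × ℂ → ℂ) p - Complex.I * (dv f : ℍ × ℂ → ℂ) p) := rfl
theorem opE'_apply_apply (f : SmoothFun) (p : ℍ × ℂ) : (opE' f : ℍ × ℂ → ℂ) p =
    p.1.im * ((dx f : ℍ × ℂ → ℂ) p + Complex.I * (dy f : ℍ × ℂ → ℂ) p)
      + p.2.im * ((du f : ℍ × ℂ → ℂ) p + Complex.I * (dv f : ℍ × ℂ → ℂ) p) := rfl

theorem im_smul_fst (g : JacobiGroup) (p : ℍ × ℂ) : ((g • p).1.im : ℂ) =
    p.1.im / (g.factor p.1 * (starRingEnd ℂ) (g.factor p.1)) := by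
  have hj := g.factor_ne_zero p.1.im_pos
  have hj' : (starRingEnd ℂ) (g.factor p.1) ≠ 0 := (map_ne_zero _).2 hj
  have hd : (g.mat 0 0 : ℂ) * g.mat 1 1 - g.mat 0 1 * g.mat 1 0 = 1 := by
    exact_mod_cast g.det_eq
  rw [← UpperHalfPlane.coe_im, ← UpperHalfPlane.coe_im, coe_im_eq, coe_im_eq, JacobiGroup.smul_fst,
    map_div₀]
  field_simp
  simp [JacobiGroup.factor]
  linear_combination ((p.1 : ℂ) - (starRingEnd ℂ) (p.1 : ℂ)) * hd

/-- The chain rule for ∂_τ produces a multiple of ∂_z. This identity says that y times that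
multiple, together with v/j, is again the new v up to the factor j̄/j, which is why the frame
contains y∂_τ + v∂_z and not y∂_τ. -/
theorem im_smul_snd (g : JacobiGroup) (p : ℍ × ℂ) : ((g • p).2.im : ℂ) *
      ((starRingEnd ℂ) (g.factor p.1) / g.factor p.1) =
    p.2.im / g.factor p.1 + p.1.im * ((g.vec 0 0 : ℂ) / g.factor p.1
        + (g.mat 0 1 : ℂ) * (p.2 + (g.vec 0 0 : ℂ) * p.1 + (g.vec 0 1 : ℂ))
          / g.factor p.1 ^ 2) := by
  have hj := g.factor_ne_zero p.1.im_pos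
  have hj' : (starRingEnd ℂ) (g.factor p.1) ≠ 0 := (map_ne_zero _).2 hj
  rw [← UpperHalfPlane.coe_im, coe_im_eq, coe_im_eq, coe_im_eq, JacobiGroup.smul_snd, map_div₀]
  field_simp
  simp [JacobiGroup.factor]
  ring

theorem opW_translate (g : JacobiGroup) (f : SmoothFun) :
    opW (translate g f) = ↑(factorUnit g)⁻¹ * translate g (opW f) := by
  refine smoothFun_ext fun p => ?_
  change _ = (g.factor p.1)⁻¹ * (opW f : ℍ × ℂ → ℂ) (g • p)
  rw [opW_apply_apply, opW_apply_apply, du, dv, dirDeriv_translate, dirDeriv_translate,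
    fderiv_eq_wirtinger, fderiv_eq_wirtinger]
  simp only [zero_div, map_zero, mul_zero, add_zero, map_div₀, Complex.conj_I, map_one]
  change _ = _ * ((du f : ℍ × ℂ → ℂ) (g • p) - _ * (dv f : ℍ × ℂ → ℂ) (g • p))
  ring_nf
  simp only [Complex.I_sq, Complex.I_pow_three]
  ring

theorem opW'_translate (g : JacobiGroup) (f : SmoothFun) :
    opW' (translate g f) = ↑(factorUnit' g)⁻¹ * translate g (opW' f) := by
  refine smoothFun_ext fun p => ?_
  change _ = ((starRingEnd ℂ) (g.factor p.1))⁻¹ * (opW' f : ℍ × ℂ → ℂ) (g • p)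
  rw [opW'_apply_apply, opW'_apply_apply, du, dv, dirDeriv_translate, dirDeriv_translate,
    fderiv_eq_wirtinger, fderiv_eq_wirtinger]
  simp only [zero_div, map_zero, mul_zero, add_zero, map_div₀, Complex.conj_I, map_one]
  change _ = _ * ((du f : ℍ × ℂ → ℂ) (g • p) + _ * (dv f : ℍ × ℂ → ℂ) (g • p))
  ring_nf
  simp only [Complex.I_sq, Complex.I_pow_three]
  ring

theorem dx_sub_dy_translate (g : JacobiGroup) (f : SmoothFun) (p : ℍ × ℂ) :
    (dx (translate g f) : ℍ × ℂ → ℂ) p - Complex.I * (dy (translate g f) : ℍ × ℂ → ℂ) p =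
      1 / g.factor p.1 ^ 2 *
        ((dx f : ℍ × ℂ → ℂ) (g • p) - Complex.I * (dy f : ℍ × ℂ → ℂ) (g • p))
      + ((g.vec 0 0 : ℂ) / g.factor p.1
        + (g.mat 0 1 : ℂ) * (p.2 + (g.vec 0 0 : ℂ) * p.1 + (g.vec 0 1 : ℂ))
          / g.factor p.1 ^ 2) *
        ((du f : ℍ × ℂ → ℂ) (g • p) - Complex.I * (dv f : ℍ × ℂ → ℂ) (g • p)) := by
  conv_lhs => rw [dx, dy, dirDeriv_translate, dirDeriv_translate, fderiv_eq_wirtinger,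
    fderiv_eq_wirtinger]
  simp only [map_div₀, Complex.conj_I, map_one, map_add, map_mul, map_pow, map_zero]
  -- The antiholomorphic terms cancel identically, so the conjugates may be treated as independent
  -- variables.
  generalize (starRingEnd ℂ) (g.factor p.1) = j'
  generalize (starRingEnd ℂ) p.2 = z'
  generalize (starRingEnd ℂ) (p.1 : ℂ) = t'
  ring_nf
  simp only [Complex.I_sq, Complex.I_pow_three]
  ring

theorem dx_add_dy_translate (g : JacobiGroup) (f : SmoothFun) (p : ℍ × ℂ) :
    (dx (translate g f) : ℍ × ℂ → ℂ) p + Complex.I * (dy (translate g f) : ℍ × ℂ → ℂ) p =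
      (starRingEnd ℂ) (1 / g.factor p.1 ^ 2) *
        ((dx f : ℍ × ℂ → ℂ) (g • p) + Complex.I * (dy f : ℍ × ℂ → ℂ) (g • p))
      + (starRingEnd ℂ) ((g.vec 0 0 : ℂ) / g.factor p.1
        + (g.mat 0 1 : ℂ) * (p.2 + (g.vec 0 0 : ℂ) * p.1 + (g.vec 0 1 : ℂ))
          / g.factor p.1 ^ 2) *
        ((du f : ℍ × ℂ → ℂ) (g • p) + Complex.I * (dv f : ℍ × ℂ → ℂ) (g • p)) := by
  conv_lhs => rw [dx, dy, dirDeriv_translate, dirDeriv_translate, fderiv_eq_wirtinger,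
    fderiv_eq_wirtinger]
  simp only [map_div₀, Complex.conj_I, map_one, map_add, map_mul, map_pow, map_zero]
  generalize (starRingEnd ℂ) (g.factor p.1) = j'
  generalize (starRingEnd ℂ) p.2 = z'
  generalize (starRingEnd ℂ) (p.1 : ℂ) = t'
  ring_nf
  simp only [Complex.I_sq, Complex.I_pow_three]
  ring

/-- Both summands scale by j̄/j: the first because y/j² = (j̄/j) · y/|j|², the second by
`im_smul_snd`. -/
theorem opE_translate (g : JacobiGroup) (f : SmoothFun) :
    opE (translate g f) =
      (factorUnit' g : SmoothFun) * ↑(factorUnit g)⁻¹ * translate g (opE f) := by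
  refine smoothFun_ext fun p => ?_
  have hj := g.factor_ne_zero p.1.im_pos
  have hj' : (starRingEnd ℂ) (g.factor p.1) ≠ 0 := (map_ne_zero _).2 hj
  change _ = (starRingEnd ℂ) (g.factor p.1) * (g.factor p.1)⁻¹ * (opE f : ℍ × ℂ → ℂ) (g • p)
  have hW := congrArg (fun F : SmoothFun => (F : ℍ × ℂ → ℂ) p) (opW_translate g f)
  change _ = (g.factor p.1)⁻¹ * (opW f : ℍ × ℂ → ℂ) (g • p) at hW
  simp only [opW_apply_apply] at hW
  rw [opE_apply_apply, opE_apply_apply, dx_sub_dy_translate, hW]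
  have h1 := im_smul_fst g p
  have h2 := im_smul_snd g p
  rw [h1]
  have h3 : (p.1.im : ℂ) * (1 / g.factor p.1 ^ 2) = (starRingEnd ℂ) (g.factor p.1) *
      (g.factor p.1)⁻¹ * (p.1.im / (g.factor p.1 * (starRingEnd ℂ) (g.factor p.1))) := by
    field_simp
  linear_combination ((dx f : ℍ × ℂ → ℂ) (g • p) - Complex.I * (dy f : ℍ × ℂ → ℂ) (g • p)) * h3
    - ((du f : ℍ × ℂ → ℂ) (g • p) - Complex.I * (dv f : ℍ × ℂ → ℂ) (g • p)) * h2

theorem opE'_translate (g : JacobiGroup) (f : SmoothFun) :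
    opE' (translate g f) =
      (factorUnit g : SmoothFun) * ↑(factorUnit' g)⁻¹ * translate g (opE' f) := by
  refine smoothFun_ext fun p => ?_
  have hj := g.factor_ne_zero p.1.im_pos
  have hj' : (starRingEnd ℂ) (g.factor p.1) ≠ 0 := (map_ne_zero _).2 hj
  change _ = g.factor p.1 * ((starRingEnd ℂ) (g.factor p.1))⁻¹ * (opE' f : ℍ × ℂ → ℂ) (g • p)
  have hW := congrArg (fun F : SmoothFun => (F : ℍ × ℂ → ℂ) p) (opW'_translate g f)
  change _ = ((starRingEnd ℂ) (g.factor p.1))⁻¹ * (opW' f : ℍ × ℂ → ℂ) (g • p) at hW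
  simp only [opW'_apply_apply] at hW
  rw [opE'_apply_apply, opE'_apply_apply, dx_add_dy_translate, hW]
  have h1 := im_smul_fst g p
  have h2 := congrArg (starRingEnd ℂ) (im_smul_snd g p)
  rw [map_mul, map_add, map_mul, Complex.conj_ofReal, Complex.conj_ofReal, map_div₀, map_div₀,
    Complex.conj_conj, Complex.conj_ofReal] at h2
  rw [h1]
  have h3 : (p.1.im : ℂ) * (starRingEnd ℂ) (1 / g.factor p.1 ^ 2) = g.factor p.1 *
      ((starRingEnd ℂ) (g.factor p.1))⁻¹ *
        (p.1.im / (g.factor p.1 * (starRingEnd ℂ) (g.factor p.1))) := by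
    simp only [map_div₀, map_one, map_pow]
    field_simp
  linear_combination ((dx f : ℍ × ℂ → ℂ) (g • p) + Complex.I * (dy f : ℍ × ℂ → ℂ) (g • p)) * h3
    - ((du f : ℍ × ℂ → ℂ) (g • p) + Complex.I * (dv f : ℍ × ℂ → ℂ) (g • p)) * h2

theorem coordY_translate (g : JacobiGroup) :
    translate g coordY = coordY * ↑(factorUnit g)⁻¹ * ↑(factorUnit' g)⁻¹ := by
  refine smoothFun_ext fun p => ?_
  change (((g • p).1.im : ℝ) : ℂ) = p.1.im * (g.factor p.1)⁻¹ * ((starRingEnd ℂ) (g.factor p.1))⁻¹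
  rw [im_smul_fst]
  rw [div_eq_mul_inv, mul_inv, mul_assoc]

/-! ### Weights -/

theorem dirDeriv_factorFun (w : ℂ × ℂ) (g : JacobiGroup) :
    dirDeriv w (factorFun g) = algebraMap ℂ SmoothFun (-(g.mat 0 1 : ℂ) * w.1) := by
  refine smoothFun_ext fun p => ?_
  have h : Set.EqOn (inCoords (factorFun g)) (fun q => g.factor q.1) domain := by
    intro q hq
    simp [inCoords, factorFun, UpperHalfPlane.ofComplex_apply_of_im_pos (show 0 < q.1.im from hq)]
  have hF : HasFDerivAt (fun q : ℂ × ℂ => g.factor q.1) _ ((p.1 : ℂ), p.2) :=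
    ((hasFDerivAt_fst (𝕜 := ℝ)).const_mul (-(g.mat 0 1 : ℂ))).add_const (g.mat 0 0 : ℂ)
  rw [dirDeriv_apply, fderiv_inCoords_of_eqOn h, hF.fderiv]
  rfl

theorem dirDeriv_factorFun' (w : ℂ × ℂ) (g : JacobiGroup) :
    dirDeriv w (factorFun' g) =
      algebraMap ℂ SmoothFun ((starRingEnd ℂ) (-(g.mat 0 1 : ℂ) * w.1)) := by
  refine smoothFun_ext fun p => ?_
  have h : Set.EqOn (inCoords (factorFun' g)) (fun q => (starRingEnd ℂ) (g.factor q.1)) domain := by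
    intro q hq
    simp [inCoords, factorFun', UpperHalfPlane.ofComplex_apply_of_im_pos (show 0 < q.1.im from hq)]
  have hF : HasFDerivAt (fun q : ℂ × ℂ => g.factor q.1) _ ((p.1 : ℂ), p.2) :=
    ((hasFDerivAt_fst (𝕜 := ℝ)).const_mul (-(g.mat 0 1 : ℂ))).add_const (g.mat 0 0 : ℂ)
  have hG := (Complex.conjCLE.toContinuousLinearMap.hasFDerivAt).comp ((p.1 : ℂ), p.2) hF
  rw [dirDeriv_apply, fderiv_inCoords_of_eqOn h]
  exact congrArg (fun L : ℂ × ℂ →L[ℝ] ℂ => L w) hG.fderiv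

/-- The entry `b` of `g = (a b; c d)` as a constant function. -/
def entryB (g : JacobiGroup) : SmoothFun := algebraMap ℂ SmoothFun (g.mat 0 1 : ℂ)

theorem factorFun'_sub (g : JacobiGroup) :
    factorFun' g - factorFun g = 2 * imUnit * entryB g * coordY := by
  refine smoothFun_ext fun p => ?_
  change (starRingEnd ℂ) (g.factor p.1) - g.factor p.1 = 2 * Complex.I * g.mat 0 1 * (p.1.im : ℂ)
  rw [← UpperHalfPlane.coe_im, coe_im_eq]
  simp [JacobiGroup.factor]
  field_simp
  ring

theorem dx_factorFun (g : JacobiGroup) : dx (factorFun g) = -entryB g := by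
  simp [dx, dirDeriv_factorFun, entryB]
theorem dy_factorFun (g : JacobiGroup) : dy (factorFun g) = -(entryB g * imUnit) := by
  simp [dy, dirDeriv_factorFun, entryB, imUnit]
theorem du_factorFun (g : JacobiGroup) : du (factorFun g) = 0 := by
  simp [du, dirDeriv_factorFun]
theorem dv_factorFun (g : JacobiGroup) : dv (factorFun g) = 0 := by
  simp [dv, dirDeriv_factorFun]
theorem dx_factorFun' (g : JacobiGroup) : dx (factorFun' g) = -entryB g := by
  simp [dx, dirDeriv_factorFun', entryB]
theorem dy_factorFun' (g : JacobiGroup) : dy (factorFun' g) = entryB g * imUnit := by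
  simp [dy, dirDeriv_factorFun', entryB, imUnit]
theorem du_factorFun' (g : JacobiGroup) : du (factorFun' g) = 0 := by
  simp [du, dirDeriv_factorFun']
theorem dv_factorFun' (g : JacobiGroup) : dv (factorFun' g) = 0 := by
  simp [dv, dirDeriv_factorFun']

/-- In this form the logarithmic derivative of j is i(j̄/j - 1): a term with the multiplier j̄/j of
`opE_translate` and a constant, which the scalar correction in `HasWeight.opE_mul` removes. -/
theorem opE_factorFun (g : JacobiGroup) :
    opE (factorFun g) = imUnit * (factorFun' g - factorFun g) := by
  rw [factorFun'_sub, opE_apply, dx_factorFun, dy_factorFun, du_factorFun, dv_factorFun]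
  linear_combination -coordY * entryB g * imUnit_mul_self
theorem opE_factorFun' (g : JacobiGroup) : opE (factorFun' g) = 0 := by
  rw [opE_apply, dx_factorFun', dy_factorFun', du_factorFun', dv_factorFun']
  linear_combination -coordY * entryB g * imUnit_mul_self
theorem opE'_factorFun (g : JacobiGroup) : opE' (factorFun g) = 0 := by
  rw [opE'_apply, dx_factorFun, dy_factorFun, du_factorFun, dv_factorFun]
  linear_combination -coordY * entryB g * imUnit_mul_self
theorem opE'_factorFun' (g : JacobiGroup) :
    opE' (factorFun' g) = imUnit * (factorFun' g - factorFun g) := by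
  rw [factorFun'_sub, opE'_apply, dx_factorFun', dy_factorFun', du_factorFun', dv_factorFun']
  linear_combination -coordY * entryB g * imUnit_mul_self
theorem opW_factorFun (g : JacobiGroup) : opW (factorFun g) = 0 := by
  simp [opW_apply, du_factorFun, dv_factorFun]
theorem opW_factorFun' (g : JacobiGroup) : opW (factorFun' g) = 0 := by
  simp [opW_apply, du_factorFun', dv_factorFun']
theorem opW'_factorFun (g : JacobiGroup) : opW' (factorFun g) = 0 := by
  simp [opW'_apply, du_factorFun, dv_factorFun]
theorem opW'_factorFun' (g : JacobiGroup) : opW' (factorFun' g) = 0 := by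
  simp [opW'_apply, du_factorFun', dv_factorFun']

theorem leibniz_zpow {δ : Module.End ℂ SmoothFun}
    (hδ : ∀ f g, δ (f * g) = δ f * g + f * δ g) (u : SmoothFunˣ) (n : ℤ) :
    δ ↑(u ^ n) = (n : SmoothFun) * (↑(u ^ n) * ↑u⁻¹ * δ ↑u) := by
  have h1 : δ 1 = 0 := by simpa using hδ 1 1
  have hinv : δ ↑u⁻¹ = -(↑u⁻¹ * ↑u⁻¹ * δ ↑u) := by
    have h := hδ ↑u ↑u⁻¹
    rw [Units.mul_inv, h1] at h
    have h2 := u.inv_mul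
    linear_combination (↑u⁻¹ : SmoothFun) * (-h) - (δ ↑u⁻¹) * h2
  induction n using Int.induction_on with
  | zero => simp [h1]
  | succ n ih =>
    rw [zpow_add_one, Units.val_mul, hδ, ih]
    push_cast
    linear_combination (-(↑(u ^ (n : ℤ)) : SmoothFun) * δ ↑u) * u.inv_mul
  | pred n ih =>
    rw [zpow_sub_one, Units.val_mul, hδ, ih, hinv]
    push_cast
    ring

/-- `(-b τ + a)^(-p)` times the conjugate of `(-b τ + a)^(-q)`. -/
def autFactor (g : JacobiGroup) (p q : ℤ) : SmoothFunˣ :=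
  factorUnit g ^ (-p) * factorUnit' g ^ (-q)

theorem autFactor_derivation {δ : Module.End ℂ SmoothFun}
    (hδ : ∀ f g, δ (f * g) = δ f * g + f * δ g) (g : JacobiGroup) (p q : ℤ) :
    δ ↑(autFactor g p q) = -↑(autFactor g p q) * (p * ↑(factorUnit g)⁻¹ * δ (factorFun g)
      + q * ↑(factorUnit' g)⁻¹ * δ (factorFun' g)) := by
  rw [autFactor, Units.val_mul, hδ, leibniz_zpow hδ, leibniz_zpow hδ]
  change _ * (_ * _ * δ (factorFun g)) * _ + _ * (_ * (_ * _ * δ (factorFun' g))) = _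
  push_cast
  ring

theorem autFactor_add_one_left (g : JacobiGroup) (p q : ℤ) :
    autFactor g (p + 1) q = autFactor g p q * (factorUnit g)⁻¹ := by
  rw [autFactor, autFactor, neg_add, zpow_add, zpow_neg_one, mul_right_comm]

theorem autFactor_add_one_right (g : JacobiGroup) (p q : ℤ) :
    autFactor g p (q + 1) = autFactor g p q * (factorUnit' g)⁻¹ := by
  rw [autFactor, autFactor, neg_add, zpow_add, zpow_neg_one, mul_assoc]

theorem autFactor_sub_one_left (g : JacobiGroup) (p q : ℤ) :
    autFactor g (p - 1) q = autFactor g p q * factorUnit g := by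
  have h := autFactor_add_one_left g (p - 1) q
  rw [sub_add_cancel] at h
  rw [h, inv_mul_cancel_right]

theorem autFactor_sub_one_right (g : JacobiGroup) (p q : ℤ) :
    autFactor g p (q - 1) = autFactor g p q * factorUnit' g := by
  have h := autFactor_add_one_right g p (q - 1)
  rw [sub_add_cancel] at h
  rw [h, inv_mul_cancel_right]

/-- `A` has weight `(p, q)`: it intertwines the action on functions with the action twisted by the
automorphy factor of weight `(p, q)`. -/
def HasWeight (p q : ℤ) (A : Module.End ℂ SmoothFun) : Prop :=
  ∀ (g : JacobiGroup) (f : SmoothFun),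
    A (translate g f) = (autFactor g p q : SmoothFun) * translate g (A f)

theorem hasWeight_zero_iff {A : Module.End ℂ SmoothFun} : HasWeight 0 0 A ↔ IsInvariant A := by
  simp [HasWeight, IsInvariant, autFactor]

theorem hasWeight_one : HasWeight 0 0 1 := by
  simp [HasWeight, autFactor]

namespace HasWeight

variable {p q : ℤ} {A : Module.End ℂ SmoothFun}

theorem y_mul (h : HasWeight p q A) : HasWeight (p - 1) (q - 1) (y * A) := by
  intro g f
  have h1 := (factorUnit g).mul_inv
  have h2 := (factorUnit' g).mul_inv
  rw [Module.End.mul_apply, h, autFactor_sub_one_left, autFactor_sub_one_right,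
    Module.End.mul_apply, y_apply, y_apply, translate_map_mul, coordY_translate]
  push_cast
  linear_combination (-(autFactor g p q : SmoothFun) * coordY * translate g (A f)) *
    (((factorUnit g : SmoothFun) * ↑(factorUnit g)⁻¹) * h2 + h1)

theorem opW_mul (h : HasWeight p q A) : HasWeight (p + 1) q (opW * A) := by
  intro g f
  rw [Module.End.mul_apply, h, MaassJacobi.opW_mul, autFactor_derivation MaassJacobi.opW_mul,
    opW_factorFun, opW_factorFun', opW_translate, autFactor_add_one_left, Module.End.mul_apply]
  push_cast
  ring

theorem opW'_mul (h : HasWeight p q A) : HasWeight p (q + 1) (opW' * A) := by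
  intro g f
  rw [Module.End.mul_apply, h, MaassJacobi.opW'_mul, autFactor_derivation MaassJacobi.opW'_mul,
    opW'_factorFun, opW'_factorFun', opW'_translate, autFactor_add_one_right, Module.End.mul_apply]
  push_cast
  ring

/-- Differentiating j^(-p) contributes -ip(j̄/j) + ip. The constant ip cancels against the
correction, and the rest is the same correction carried through the new factor j̄/j. -/
theorem opE_mul (h : HasWeight p q A) :
    HasWeight (p + 1) (q - 1) ((opE + (-(Complex.I * p)) • 1) * A) := by
  intro g f
  have hc : (-(Complex.I * p)) • (1 : Module.End ℂ SmoothFun) =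
      -(Complex.I • ((p : ℂ) • 1)) := by
    module
  have hp : ∀ F : SmoothFun, ((p : ℂ) • F) = (p : SmoothFun) * F := fun F => by
    rw [Algebra.smul_def, map_intCast]
  rw [Module.End.mul_apply, h, hc]
  simp only [LinearMap.add_apply, LinearMap.neg_apply, LinearMap.smul_apply, Module.End.one_apply,
    Module.End.mul_apply, I_smul, hp]
  rw [MaassJacobi.opE_mul, autFactor_derivation MaassJacobi.opE_mul,
    opE_factorFun, opE_factorFun', opE_translate, autFactor_sub_one_right, autFactor_add_one_left,
    map_add, map_neg, translate_map_mul, translate_map_mul]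
  have h1 : translate g imUnit = imUnit := rfl
  have h2 : translate g (p : SmoothFun) = p := rfl
  have h3 := (factorUnit g).inv_mul
  rw [h1, h2]
  push_cast
  change _ + _ * (factorFun' g * _ * _) + _ = _ * factorFun' g * _
  change _ * factorFun g = 1 at h3
  linear_combination (autFactor g p q : SmoothFun) * p * imUnit * translate g (A f) * h3

theorem opE'_mul (h : HasWeight p q A) :
    HasWeight (p - 1) (q + 1) ((opE' + (Complex.I * q) • 1) * A) := by
  intro g f
  have hc : (Complex.I * q) • (1 : Module.End ℂ SmoothFun) = (Complex.I • ((q : ℂ) • 1)) := by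
    rw [mul_smul]
  have hp : ∀ F : SmoothFun, ((q : ℂ) • F) = (q : SmoothFun) * F := fun F => by
    rw [Algebra.smul_def, map_intCast]
  rw [Module.End.mul_apply, h, hc]
  simp only [LinearMap.add_apply, LinearMap.smul_apply, Module.End.one_apply, Module.End.mul_apply,
    I_smul, hp]
  rw [MaassJacobi.opE'_mul, autFactor_derivation MaassJacobi.opE'_mul,
    opE'_factorFun, opE'_factorFun', opE'_translate, autFactor_sub_one_left,
    autFactor_add_one_right, map_add, translate_map_mul, translate_map_mul]
  have h1 : translate g imUnit = imUnit := rfl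
  have h2 : translate g (q : SmoothFun) = q := rfl
  have h3 := (factorUnit' g).inv_mul
  rw [h1, h2]
  push_cast
  change _ + _ * (factorFun g * _ * _) + _ = _ * factorFun g * _
  change _ * factorFun' g = 1 at h3
  linear_combination -(autFactor g p q : SmoothFun) * q * imUnit * translate g (A f) * h3

end HasWeight

/-! ### Invariance of the four operators -/

theorem isInvariant_opD : IsInvariant opD := by
  have h := ((hasWeight_one.opE'_mul).opE_mul)
  rw [← hasWeight_zero_iff, opD_eq]
  simpa using h

theorem isInvariant_opPsi : IsInvariant opPsi := by
  have h := hasWeight_one.opW'_mul.opW_mul.y_mul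
  rw [← hasWeight_zero_iff, opPsi_eq]
  simpa [mul_assoc] using h

theorem isInvariant_opP : IsInvariant opP := by
  have h := hasWeight_one.opW_mul.opW_mul.opE'_mul.y_mul
  rw [← hasWeight_zero_iff, opP]
  simpa [mul_assoc, pow_two] using h

theorem isInvariant_opP' : IsInvariant opP' := by
  have h := hasWeight_one.opW'_mul.opW'_mul.opE_mul.y_mul
  rw [← hasWeight_zero_iff, opP']
  simpa [mul_assoc, pow_two] using h

/-- The algebra of invariant operators. -/
def invariantSubalgebra : Subalgebra ℂ (Module.End ℂ SmoothFun) where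
  carrier := {A | IsInvariant A}
  mul_mem' {A B} hA hB g f := by
    rw [Module.End.mul_apply, hB g f, hA g (B f), Module.End.mul_apply]
  add_mem' {A B} hA hB g f := by
    rw [LinearMap.add_apply, hA g f, hB g f, LinearMap.add_apply, map_add]
  algebraMap_mem' c g f := rfl

theorem mem_invariantSubalgebra {A : Module.End ℂ SmoothFun} :
    A ∈ invariantSubalgebra ↔ IsInvariant A := Iff.rfl

theorem isInvariant_opD₁ : IsInvariant opD₁ := by
  have h1 := mem_invariantSubalgebra.2 isInvariant_opP
  have h2 := mem_invariantSubalgebra.2 isInvariant_opP'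
  have h3 := mem_invariantSubalgebra.2 isInvariant_opPsi
  rw [opD₁_eq, ← mem_invariantSubalgebra]
  exact Subalgebra.add_mem _ h3
    (Subalgebra.add_mem _ (Subalgebra.smul_mem _ h1 _) (Subalgebra.smul_mem _ h2 _))

theorem isInvariant_opD₂ : IsInvariant opD₂ := by
  have h1 := mem_invariantSubalgebra.2 isInvariant_opP
  have h2 := mem_invariantSubalgebra.2 isInvariant_opP'
  rw [opD₂_eq, ← mem_invariantSubalgebra]
  exact Subalgebra.smul_mem _ (Subalgebra.add_mem _ h1 h2) _

/-! ### Filtrations with commutative associated graded algebra -/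

section Filtration

variable {R A : Type*} [CommRing R] [Semiring A] [Algebra R A]

/-- The part of filtration degree less than `n` of the filtration by the powers of `S`. -/
def lowerPart (S : Submodule R A) : ℕ → Submodule R A
  | 0 => ⊥
  | n + 1 => S ^ n

variable {S : Submodule R A}

theorem pow_mono_of_one_mem (h1 : (1 : A) ∈ S) {m n : ℕ} (h : m ≤ n) : S ^ m ≤ S ^ n :=
  pow_le_pow_right₀ (Submodule.one_le.2 h1) h

theorem lowerPart_mono (h1 : (1 : A) ∈ S) {m n : ℕ} (h : m ≤ n) :
    lowerPart S m ≤ lowerPart S n := by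
  cases m with
  | zero => exact bot_le
  | succ m =>
    cases n with
    | zero => omega
    | succ n => exact pow_mono_of_one_mem h1 (by omega)

theorem lowerPart_le (h1 : (1 : A) ∈ S) (n : ℕ) : lowerPart S n ≤ S ^ n :=
  lowerPart_mono h1 n.le_succ

theorem pow_mul_mem {m n : ℕ} {a b : A} (ha : a ∈ S ^ m) (hb : b ∈ S ^ n) :
    a * b ∈ S ^ (m + n) := by
  rw [pow_add]
  exact Submodule.mul_mem_mul ha hb

theorem lowerPart_mul_mem {m n : ℕ} {a b : A} (ha : a ∈ lowerPart S m) (hb : b ∈ S ^ n) :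
    a * b ∈ lowerPart S (m + n) := by
  cases m with
  | zero =>
    rw [(Submodule.mem_bot R).1 ha, zero_mul]
    exact zero_mem _
  | succ m =>
    rw [Nat.succ_add]
    exact pow_mul_mem ha hb

theorem mul_lowerPart_mem {m n : ℕ} {a b : A} (ha : a ∈ S ^ m) (hb : b ∈ lowerPart S n) :
    a * b ∈ lowerPart S (m + n) := by
  cases n with
  | zero =>
    rw [(Submodule.mem_bot R).1 hb, mul_zero]
    exact zero_mem _
  | succ n => exact pow_mul_mem ha hb

theorem smul_mem_lowerPart_succ (r : R) {n : ℕ} {a : A} (ha : a ∈ S ^ n) :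
    r • a ∈ lowerPart S (n + 1) := Submodule.smul_mem (S ^ n) r ha

/-- By [a, st] = s[a, t] + [a, s]t, bracketing with an element of S does not raise the degree. -/
theorem exists_mul_eq_swap_add_of_mem (hS : ∀ a ∈ S, ∀ b ∈ S, ∃ r ∈ S, a * b = b * a + r)
    {a b : A} {n : ℕ} (ha : a ∈ S) (hb : b ∈ S ^ n) : ∃ r ∈ S ^ n, a * b = b * a + r := by
  induction n generalizing b with
  | zero =>
    rw [pow_zero, Submodule.mem_one] at hb
    obtain ⟨r, rfl⟩ := hb
    exact ⟨0, zero_mem _, by rw [Algebra.commutes, add_zero]⟩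
  | succ n ih =>
    rw [pow_succ'] at hb
    induction hb using Submodule.mul_induction_on' with
    | mem_mul_mem s hs t ht =>
      obtain ⟨r, hr, h⟩ := hS a ha s hs
      obtain ⟨r', hr', h'⟩ := ih ht
      refine ⟨s * r' + r * t, ?_, ?_⟩
      · rw [pow_succ']
        exact add_mem (Submodule.mul_mem_mul hs hr') (Submodule.mul_mem_mul hr ht)
      · rw [← mul_assoc, h, add_mul, mul_assoc, h', mul_add, mul_assoc, add_assoc]
    | add x _ y _ hx hy =>
      obtain ⟨r, hr, h⟩ := hx
      obtain ⟨r', hr', h'⟩ := hy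
      exact ⟨r + r', add_mem hr hr', by rw [mul_add, add_mul, h, h', add_add_add_comm]⟩

/-- The bracket has degree one less than the product, so the associated graded algebra is
commutative. -/
theorem exists_mul_eq_swap_add (hS : ∀ a ∈ S, ∀ b ∈ S, ∃ r ∈ S, a * b = b * a + r)
    {a b : A} {m n : ℕ} (ha : a ∈ S ^ m) (hb : b ∈ S ^ n) :
    ∃ r ∈ lowerPart S (m + n), a * b = b * a + r := by
  induction m generalizing a with
  | zero =>
    rw [pow_zero, Submodule.mem_one] at ha
    obtain ⟨r, rfl⟩ := ha
    exact ⟨0, zero_mem _, by rw [Algebra.commutes, add_zero]⟩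
  | succ m ih =>
    rw [pow_succ'] at ha
    induction ha using Submodule.mul_induction_on' with
    | mem_mul_mem s hs t ht =>
      obtain ⟨r, hr, h⟩ := exists_mul_eq_swap_add_of_mem hS hs hb
      obtain ⟨r', hr', h'⟩ := ih ht
      refine ⟨s * r' + r * t, add_mem ?_ ?_, ?_⟩
      · have := mul_lowerPart_mem (m := 1) (by rwa [pow_one]) hr'
        rwa [show 1 + (m + n) = m + 1 + n by ring] at this
      · rw [show m + 1 + n = (n + m) + 1 by ring]
        exact pow_mul_mem hr ht
      · rw [mul_assoc, h', mul_add, ← mul_assoc, h, add_mul, ← mul_assoc, add_assoc,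
          add_comm (r * t)]
    | add x _ y _ hx hy =>
      obtain ⟨r, hr, h⟩ := hx
      obtain ⟨r', hr', h'⟩ := hy
      exact ⟨r + r', add_mem hr hr', by rw [mul_add, add_mul, h, h', add_add_add_comm]⟩

/-- Congruence modulo the part of filtration degree less than `n`. -/
def EqModLower (S : Submodule R A) (n : ℕ) (a b : A) : Prop := ∃ r ∈ lowerPart S n, a = b + r

namespace EqModLower

variable {n m : ℕ} {a b c : A}

theorem refl (a : A) : EqModLower S n a a := ⟨0, zero_mem _, (add_zero a).symm⟩

theorem symm (h : EqModLower S n a b) : EqModLower S n b a := by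
  obtain ⟨r, hr, rfl⟩ := h
  -- Subtraction is not available in the semiring A, so the sign is taken from the scalars.
  exact ⟨(-1 : R) • r, Submodule.smul_mem _ _ hr, by module⟩

theorem trans (h : EqModLower S n a b) (h' : EqModLower S n b c) : EqModLower S n a c := by
  obtain ⟨r, hr, rfl⟩ := h
  obtain ⟨r', hr', rfl⟩ := h'
  exact ⟨r' + r, add_mem hr' hr, add_assoc _ _ _⟩

theorem mul_right (h : EqModLower S n a b) (hc : c ∈ S ^ m) :
    EqModLower S (n + m) (a * c) (b * c) := by
  obtain ⟨r, hr, rfl⟩ := h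
  exact ⟨r * c, lowerPart_mul_mem hr hc, add_mul _ _ _⟩

theorem mul_left (h : EqModLower S n a b) (hc : c ∈ S ^ m) :
    EqModLower S (m + n) (c * a) (c * b) := by
  obtain ⟨r, hr, rfl⟩ := h
  exact ⟨c * r, mul_lowerPart_mem hc hr, mul_add _ _ _⟩

theorem mem_pow (h1 : (1 : A) ∈ S) (h : EqModLower S n a b) (hb : b ∈ S ^ n) : a ∈ S ^ n := by
  obtain ⟨r, hr, rfl⟩ := h
  exact add_mem hb (lowerPart_le h1 n hr)

end EqModLower

theorem eqModLower_mul_mul_mul (hS : ∀ a ∈ S, ∀ b ∈ S, ∃ r ∈ S, a * b = b * a + r)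
    {a b c d : A} {k l m n : ℕ}
    (ha : a ∈ S ^ k) (hb : b ∈ S ^ l) (hc : c ∈ S ^ m) (hd : d ∈ S ^ n) :
    EqModLower S (k + l + (m + n)) (a * b * (c * d)) (a * c * (b * d)) := by
  obtain ⟨r, hr, h⟩ := exists_mul_eq_swap_add hS hb hc
  refine ⟨a * (r * d), ?_, ?_⟩
  · rw [show k + l + (m + n) = k + (l + m + n) by ring]
    exact mul_lowerPart_mem ha (lowerPart_mul_mem hr hd)
  · rw [mul_assoc, ← mul_assoc b, h, add_mul, mul_add, mul_assoc c, mul_assoc a]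

/-- Ordered monomials are multiplicative up to terms of lower degree. -/
theorem eqModLower_ordered_monomial_mul (hS : ∀ a ∈ S, ∀ b ∈ S, ∃ r ∈ S, a * b = b * a + r)
    {x₁ x₂ x₃ x₄ : A} (hx₁ : x₁ ∈ S) (hx₂ : x₂ ∈ S)
    (hx₃ : x₃ ∈ S) (hx₄ : x₄ ∈ S) (a b c d a' b' c' d' : ℕ) :
    EqModLower S (a + b + c + d + (a' + b' + c' + d'))
      (x₁ ^ a * x₂ ^ b * x₃ ^ c * x₄ ^ d * (x₁ ^ a' * x₂ ^ b' * x₃ ^ c' * x₄ ^ d'))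
      (x₁ ^ (a + a') * x₂ ^ (b + b') * x₃ ^ (c + c') * x₄ ^ (d + d')) := by
  have p₁ := fun n : ℕ => Submodule.pow_mem_pow S hx₁ n
  have p₂ := fun n : ℕ => Submodule.pow_mem_pow S hx₂ n
  have p₃ := fun n : ℕ => Submodule.pow_mem_pow S hx₃ n
  have p₄ := fun n : ℕ => Submodule.pow_mem_pow S hx₄ n
  -- Each of the three exchanges moves one power of the second monomial next to its partner. They
  -- are applied from the last variable to the first.
  have q₂ := eqModLower_mul_mul_mul hS (p₁ a) (p₂ b) (p₁ a') (p₂ b')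
  have q₃ := eqModLower_mul_mul_mul hS (pow_mul_mem (p₁ a) (p₂ b)) (p₃ c)
    (pow_mul_mem (p₁ a') (p₂ b')) (p₃ c')
  have q₄ := eqModLower_mul_mul_mul hS
    (pow_mul_mem (pow_mul_mem (p₁ a) (p₂ b)) (p₃ c)) (p₄ d)
    (pow_mul_mem (pow_mul_mem (p₁ a') (p₂ b')) (p₃ c')) (p₄ d')
  have r₃ := q₃.mul_right (pow_mul_mem (p₄ d) (p₄ d'))
  have r₂ := (q₂.mul_right (pow_mul_mem (p₃ c) (p₃ c'))).mul_right (pow_mul_mem (p₄ d) (p₄ d'))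
  rw [show a + b + (a' + b') + (c + c') + (d + d') = a + b + c + d + (a' + b' + c' + d') by ring]
    at r₂
  rw [show a + b + c + (a' + b' + c') + (d + d') = a + b + c + d + (a' + b' + c' + d') by ring]
    at r₃
  rw [pow_add, pow_add, pow_add, pow_add]
  exact (q₄.trans r₃).trans r₂

end Filtration

/-! ### The filtered algebra generated by the frame -/

/-- The span of the frame and the identity. -/
def frameSpan : Submodule ℂ (Module.End ℂ SmoothFun) :=
  Submodule.span ℂ {1, opE, opE', opW, opW'}

theorem one_mem_frameSpan : 1 ∈ frameSpan := Submodule.subset_span (by simp)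
theorem opE_mem_frameSpan : opE ∈ frameSpan := Submodule.subset_span (by simp)
theorem opE'_mem_frameSpan : opE' ∈ frameSpan := Submodule.subset_span (by simp)
theorem opW_mem_frameSpan : opW ∈ frameSpan := Submodule.subset_span (by simp)
theorem opW'_mem_frameSpan : opW' ∈ frameSpan := Submodule.subset_span (by simp)

/-- The bracket is bilinear, so generators suffice: the six relations, their reversals, and the
trivial pairs (equal, or containing 1). -/
theorem frameSpan_swap (a : Module.End ℂ SmoothFun) (ha : a ∈ frameSpan)
    (b : Module.End ℂ SmoothFun) (hb : b ∈ frameSpan) : ∃ r ∈ frameSpan, a * b = b * a + r := by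
  have hsymm : ∀ {a b : Module.End ℂ SmoothFun}, (∃ r ∈ frameSpan, a * b = b * a + r) →
      ∃ r ∈ frameSpan, b * a = a * b + r := by
    rintro a b ⟨r, hr, h⟩
    exact ⟨(-1 : ℂ) • r, Submodule.smul_mem _ _ hr, by rw [h]; module⟩
  have e1 : ∃ r ∈ frameSpan, opE * opW = opW * opE + r :=
    ⟨_, Submodule.smul_mem _ _ opW_mem_frameSpan, opE_opW⟩
  have e2 : ∃ r ∈ frameSpan, opE * opW' = opW' * opE + r :=
    ⟨_, Submodule.smul_mem _ _ (Submodule.smul_mem _ _ opW_mem_frameSpan), opE_opW'⟩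
  have e3 : ∃ r ∈ frameSpan, opE' * opW = opW * opE' + r :=
    ⟨_, Submodule.smul_mem _ _ opW'_mem_frameSpan, opE'_opW⟩
  have e4 : ∃ r ∈ frameSpan, opE' * opW' = opW' * opE' + r :=
    ⟨_, Submodule.smul_mem _ _ (Submodule.smul_mem _ _ opW'_mem_frameSpan), opE'_opW'⟩
  have e5 : ∃ r ∈ frameSpan, opE * opE' = opE' * opE + r :=
    ⟨_, Submodule.smul_mem _ _ (Submodule.smul_mem _ _
      (Submodule.add_mem _ opE_mem_frameSpan opE'_mem_frameSpan)), opE_opE'⟩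
  have e6 : ∃ r ∈ frameSpan, opW * opW' = opW' * opW + r :=
    ⟨0, zero_mem _, by rw [opW_opW', add_zero]⟩
  have e1' := hsymm e1
  have e2' := hsymm e2
  have e3' := hsymm e3
  have e4' := hsymm e4
  have e5' := hsymm e5
  have e6' := hsymm e6
  induction ha using Submodule.span_induction with
  | zero => exact ⟨0, zero_mem _, by simp⟩
  | add x y _ _ hx hy =>
    obtain ⟨r, hr, h⟩ := hx
    obtain ⟨r', hr', h'⟩ := hy
    exact ⟨r + r', add_mem hr hr', by rw [mul_add, add_mul, h, h', add_add_add_comm]⟩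
  | smul c x _ hx =>
    obtain ⟨r, hr, h⟩ := hx
    exact ⟨c • r, Submodule.smul_mem _ _ hr, by
      rw [smul_mul_assoc, mul_smul_comm, h, smul_add]⟩
  | mem x hx =>
    induction hb using Submodule.span_induction with
    | zero => exact ⟨0, zero_mem _, by simp⟩
    | add z w _ _ hz hw =>
      obtain ⟨r, hr, h⟩ := hz
      obtain ⟨r', hr', h'⟩ := hw
      exact ⟨r + r', add_mem hr hr', by rw [mul_add, add_mul, h, h', add_add_add_comm]⟩
    | smul c z _ hz =>
      obtain ⟨r, hr, h⟩ := hz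
      exact ⟨c • r, Submodule.smul_mem _ _ hr, by
        rw [smul_mul_assoc, mul_smul_comm, h, smul_add]⟩
    | mem z hz =>
      simp only [Set.mem_insert_iff, Set.mem_singleton_iff] at hx hz
      rcases hx with rfl | rfl | rfl | rfl | rfl <;> rcases hz with rfl | rfl | rfl | rfl | rfl <;>
        first
        | assumption
        | exact ⟨0, zero_mem _, (add_zero _).symm⟩

/-- Elements of the filtered algebra commute with `y` up to terms of lower degree. -/
theorem exists_mul_y_eq {n : ℕ} {u : Module.End ℂ SmoothFun} (hu : u ∈ frameSpan ^ n) :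
    ∃ w, u * y = y * w ∧ EqModLower frameSpan n w u := by
  have hE : opE * y = y * (opE + (-Complex.I) • 1) := by
    ext1 f
    simp [y_apply, opE_mul, opE_y, I_smul]
    ring
  have hE' : opE' * y = y * (opE' + Complex.I • 1) := by
    ext1 f
    simp [y_apply, opE'_mul, opE'_y, I_smul]
    ring
  have hW : opW * y = y * opW := by
    ext1 f
    simp [y_apply, opW_mul, opW_y]
  have hW' : opW' * y = y * opW' := by
    ext1 f
    simp [y_apply, opW'_mul, opW'_y]
  -- Since y is an eigenfunction of every frame field, moving y to the left across a degree one
  -- element only adds a scalar to that element.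
  have hs : ∀ s ∈ frameSpan, ∃ c : ℂ, s * y = y * (s + c • 1) := by
    intro s hs
    induction hs using Submodule.span_induction with
    | zero => exact ⟨0, by simp⟩
    | add a b _ _ ha hb =>
      obtain ⟨c, hc⟩ := ha
      obtain ⟨d, hd⟩ := hb
      refine ⟨c + d, ?_⟩
      rw [add_mul, hc, hd, ← mul_add]
      congr 1
      module
    | smul r a _ ha =>
      obtain ⟨c, hc⟩ := ha
      refine ⟨r * c, ?_⟩
      rw [smul_mul_assoc, hc, ← mul_smul_comm]
      congr 1
      module
    | mem s hs =>
      simp only [Set.mem_insert_iff, Set.mem_singleton_iff] at hs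
      rcases hs with rfl | rfl | rfl | rfl | rfl
      · exact ⟨0, by simp⟩
      · exact ⟨_, hE⟩
      · exact ⟨_, hE'⟩
      · exact ⟨0, by simpa using hW⟩
      · exact ⟨0, by simpa using hW'⟩
  induction n generalizing u with
  | zero =>
    refine ⟨u, ?_, .refl _⟩
    rw [pow_zero, Submodule.mem_one] at hu
    obtain ⟨r, rfl⟩ := hu
    exact Algebra.commutes _ _
  | succ n ih =>
    rw [pow_succ'] at hu
    induction hu using Submodule.mul_induction_on' with
    | mem_mul_mem s hs' t ht =>
      obtain ⟨c, hc⟩ := hs s hs'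
      obtain ⟨t', h1, h2⟩ := ih ht
      refine ⟨(s + c • 1) * t', by rw [mul_assoc, h1, ← mul_assoc, hc, mul_assoc], ?_⟩
      have h3 : EqModLower frameSpan (n + 1) ((s + c • 1) * t') (s * t') :=
        ⟨c • t', smul_mem_lowerPart_succ c (h2.mem_pow one_mem_frameSpan ht), by
          rw [add_mul, smul_mul_assoc, one_mul]⟩
      have h4 := h2.mul_left (c := s) (m := 1) (by rwa [pow_one])
      rw [add_comm] at h4
      exact h3.trans h4
    | add a _ b _ ha hb =>
      obtain ⟨w, h1, r, hr, rfl⟩ := ha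
      obtain ⟨w', h1', r', hr', rfl⟩ := hb
      exact ⟨_, by rw [add_mul, h1, h1', ← mul_add], r + r', add_mem hr hr',
        add_add_add_comm _ _ _ _⟩

/-! ### Monomials of pure weight -/

/-- `(Ē)^b W^c W̄^d`, with the powers of `Ē` corrected so as to have pure weight. -/
def lowMono (b c d : ℕ) : Module.End ℂ SmoothFun :=
  match b with
  | 0 => opW ^ c * opW' ^ d
  | b + 1 => (opE' + (Complex.I * ((d + b : ℤ) : ℂ)) • 1) * lowMono b c d

/-- `E^a Ē^b W^c W̄^d`, with the powers of `E` and `Ē` corrected so as to have pure weight. -/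
def mono (a b c d : ℕ) : Module.End ℂ SmoothFun :=
  match a with
  | 0 => lowMono b c d
  | a + 1 => (opE + (-(Complex.I * ((c - b + a : ℤ) : ℂ))) • 1) * mono a b c d

theorem mono_zero : mono 0 0 0 0 = 1 := by simp [mono, lowMono]

/-- The fields E, Ē, W, W̄ shift the weight by (1,-1), (-1,1), (1,0), (0,1). The scalars in
`lowMono` and `mono` are the corrections for the weight reached at each stage: q = d + b for Ē and p
= c - b + a for E. -/
theorem hasWeight_mono (a b c d : ℕ) :
    HasWeight (c - b + a) (d + b - a) (mono a b c d) := by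
  induction a with
  | zero =>
    rw [mono]
    induction b with
    | zero =>
      rw [lowMono]
      have h : ∀ d : ℕ, HasWeight 0 d (opW' ^ d) := fun d => by
        induction d with
        | zero => exact hasWeight_one
        | succ d ih => rw [pow_succ']; exact_mod_cast ih.opW'_mul
      induction c with
      | zero => simpa using h d
      | succ c ih =>
        rw [pow_succ', mul_assoc]
        have := ih.opW_mul
        convert this using 1
        push_cast
        ring
    | succ b ih =>
      rw [lowMono]
      have := ih.opE'_mul
      simp only [Nat.cast_zero, add_zero, sub_zero] at this
      convert this using 1 <;> push_cast <;> ring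
  | succ a ih =>
    rw [mono]
    have := ih.opE_mul
    convert this using 1 <;> push_cast <;> ring

/-- `E^a Ē^b W^c W̄^d` -/
def leadMono (a b c d : ℕ) : Module.End ℂ SmoothFun := opE ^ a * opE' ^ b * opW ^ c * opW' ^ d

/-- The scalar corrections that give pure weight do not change the leading term. -/
theorem eqModLower_add_smul_mul {x u w : Module.End ℂ SmoothFun} {n : ℕ} (c : ℂ)
    (hx : x ∈ frameSpan) (hw : w ∈ frameSpan ^ n) (h : EqModLower frameSpan n u w) :
    EqModLower frameSpan (n + 1) ((x + c • 1) * u) (x * w) := by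
  have h4 := h.mul_left (c := x) (m := 1) (by rwa [pow_one])
  rw [add_comm] at h4
  refine EqModLower.trans ⟨c • u, ?_, ?_⟩ h4
  · exact smul_mem_lowerPart_succ c (h.mem_pow one_mem_frameSpan hw)
  · rw [add_mul, smul_mul_assoc, one_mul]

theorem leadMono_mem (a b c d : ℕ) : leadMono a b c d ∈ frameSpan ^ (a + b + c + d) :=
  pow_mul_mem (pow_mul_mem (pow_mul_mem (Submodule.pow_mem_pow _ opE_mem_frameSpan _)
    (Submodule.pow_mem_pow _ opE'_mem_frameSpan _)) (Submodule.pow_mem_pow _ opW_mem_frameSpan _))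
    (Submodule.pow_mem_pow _ opW'_mem_frameSpan _)

theorem mono_eqModLower (a b c d : ℕ) :
    EqModLower frameSpan (a + b + c + d) (mono a b c d) (leadMono a b c d) := by
  induction a with
  | zero =>
    rw [mono]
    induction b with
    | zero =>
      have : lowMono 0 c d = leadMono 0 0 c d := by simp [lowMono, leadMono]
      rw [this]
      exact .refl _
    | succ b ih =>
      have h := eqModLower_add_smul_mul (Complex.I * ((d + b : ℤ) : ℂ)) opE'_mem_frameSpan
        (leadMono_mem 0 b c d) ih
      rw [lowMono]
      convert h using 1
      · ring
      · simp only [leadMono, pow_succ', pow_zero, one_mul, mul_assoc]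
  | succ a ih =>
    have h := eqModLower_add_smul_mul (-(Complex.I * ((c - b + a : ℤ) : ℂ))) opE_mem_frameSpan
      (leadMono_mem a b c d) ih
    rw [mono]
    convert h using 1
    · ring
    · simp only [leadMono, pow_succ', mul_assoc]

theorem mono_mem (a b c d : ℕ) : mono a b c d ∈ frameSpan ^ (a + b + c + d) :=
  (mono_eqModLower a b c d).mem_pow one_mem_frameSpan (leadMono_mem a b c d)

theorem leadMono_mul (a b c d a' b' c' d' : ℕ) :
    EqModLower frameSpan (a + b + c + d + (a' + b' + c' + d'))
      (leadMono a b c d * leadMono a' b' c' d') (leadMono (a + a') (b + b') (c + c') (d + d')) :=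
  eqModLower_ordered_monomial_mul frameSpan_swap opE_mem_frameSpan opE'_mem_frameSpan
    opW_mem_frameSpan opW'_mem_frameSpan a b c d a' b' c' d'

theorem eqModLower_mono_mul {a b c d a' b' c' d' : ℕ} {u u' : Module.End ℂ SmoothFun}
    (hu : EqModLower frameSpan (a + b + c + d) u (leadMono a b c d))
    (hu' : EqModLower frameSpan (a' + b' + c' + d') u' (leadMono a' b' c' d')) :
    EqModLower frameSpan (a + b + c + d + (a' + b' + c' + d'))
      (u * u') (mono (a + a') (b + b') (c + c') (d + d')) := by
  have h1 := hu.mul_right (hu'.mem_pow one_mem_frameSpan (leadMono_mem a' b' c' d'))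
  have h2 := hu'.mul_left (leadMono_mem a b c d)
  have h3 := leadMono_mul a b c d a' b' c' d'
  have h4 := (mono_eqModLower (a + a') (b + b') (c + c') (d + d')).symm
  rw [show a + a' + (b + b') + (c + c') + (d + d') = a + b + c + d + (a' + b' + c' + d') by ring]
    at h4
  exact ((h1.trans h2).trans h3).trans h4

/-- The span of the monomials of degree at most `n`. -/
def monoSpan (n : ℕ) : Submodule ℂ (Module.End ℂ SmoothFun) :=
  Submodule.span ℂ {u | ∃ a b c d : ℕ, a + b + c + d ≤ n ∧ u = mono a b c d}

theorem monoSpan_mono {m n : ℕ} (h : m ≤ n) : monoSpan m ≤ monoSpan n :=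
  Submodule.span_mono fun _ ⟨a, b, c, d, hm, hu⟩ => ⟨a, b, c, d, hm.trans h, hu⟩

/-- The spanning half of a Poincaré–Birkhoff–Witt statement: multiplying a monomial by a frame field
gives a monomial modulo lower degree, which the induction hypothesis covers. Linear independence is
never needed. -/
theorem frameSpan_pow_le (n : ℕ) : frameSpan ^ n ≤ monoSpan n := by
  induction n with
  | zero =>
    intro u hu
    rw [pow_zero, Submodule.mem_one] at hu
    obtain ⟨r, rfl⟩ := hu
    rw [Algebra.algebraMap_eq_smul_one]
    exact Submodule.smul_mem _ _ (Submodule.subset_span ⟨0, 0, 0, 0, le_rfl, mono_zero.symm⟩)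
  | succ n ih =>
    have key : ∀ {a b c d a' b' c' d' : ℕ}, a + b + c + d = 1 → a' + b' + c' + d' ≤ n →
        leadMono a b c d * mono a' b' c' d' ∈ monoSpan (n + 1) := by
      intro a b c d a' b' c' d' h1 hn
      obtain ⟨r, hr, h⟩ := eqModLower_mono_mul (a := a) (b := b) (c := c) (d := d) (.refl _)
        (mono_eqModLower a' b' c' d')
      rw [h]
      refine add_mem (Submodule.subset_span ⟨_, _, _, _, by omega, rfl⟩) ?_
      -- `lowerPart frameSpan (n + 1)` is `frameSpan ^ n` by definition.
      exact monoSpan_mono n.le_succ (ih (lowerPart_mono (n := n + 1) one_mem_frameSpan (by omega) hr))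
    have hE : opE = leadMono 1 0 0 0 := by simp [leadMono]
    have hE' : opE' = leadMono 0 1 0 0 := by simp [leadMono]
    have hW : opW = leadMono 0 0 1 0 := by simp [leadMono]
    have hW' : opW' = leadMono 0 0 0 1 := by simp [leadMono]
    rw [pow_succ', Submodule.mul_le]
    intro s hs t ht
    have ht' := ih ht
    clear ht
    induction ht' using Submodule.span_induction with
    | zero => rw [mul_zero]; exact zero_mem _
    | add x y _ _ hx hy => rw [mul_add]; exact add_mem hx hy
    | smul r x _ hx => rw [mul_smul_comm]; exact Submodule.smul_mem _ _ hx
    | mem x hx =>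
      obtain ⟨a, b, c, d, hn, rfl⟩ := hx
      induction hs using Submodule.span_induction with
      | zero => rw [zero_mul]; exact zero_mem _
      | add x y _ _ hx hy => rw [add_mul]; exact add_mem hx hy
      | smul r x _ hx => rw [smul_mul_assoc]; exact Submodule.smul_mem _ _ hx
      | mem x hx =>
        simp only [Set.mem_insert_iff, Set.mem_singleton_iff] at hx
        rcases hx with rfl | rfl | rfl | rfl | rfl
        · rw [one_mul]
          exact Submodule.subset_span ⟨a, b, c, d, hn.trans n.le_succ, rfl⟩
        · rw [hE]; exact key rfl hn
        · rw [hE']; exact key rfl hn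
        · rw [hW]; exact key rfl hn
        · rw [hW']; exact key rfl hn

/-! ### Values at the base point -/

/-- The base point `(i, 0)`. -/
def basePoint : ℍ × ℂ := (UpperHalfPlane.I, 0)

/-- Evaluation at a point. -/
def evalAt (p : ℍ × ℂ) : SmoothFun →ₐ[ℂ] ℂ :=
  (Pi.evalAlgHom ℂ (fun _ : ℍ × ℂ => ℂ) p).comp SmoothFun.val

theorem evalAt_apply (p : ℍ × ℂ) (f : SmoothFun) : evalAt p f = (f : ℍ × ℂ → ℂ) p := rfl

/-- The functional `f ↦ (A f)(i, 0)`. -/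
def atBase (A : Module.End ℂ SmoothFun) : SmoothFun →ₗ[ℂ] ℂ := (evalAt basePoint).toLinearMap ∘ₗ A

theorem atBase_apply (A : Module.End ℂ SmoothFun) (f : SmoothFun) :
    atBase A f = (A f : ℍ × ℂ → ℂ) basePoint := rfl

theorem atBase_add (A B : Module.End ℂ SmoothFun) : atBase (A + B) = atBase A + atBase B := by
  ext f
  rfl

theorem atBase_smul (c : ℂ) (A : Module.End ℂ SmoothFun) : atBase (c • A) = c • atBase A := by
  ext f
  rfl

theorem atBase_zero : atBase 0 = 0 := by
  ext f
  rfl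

/-- A coefficient on the left is seen only through its value at the base point. Variable
coefficients thus become scalars, and powers of y disappear because y = 1 there. -/
theorem atBase_mulOp_mul (a : SmoothFun) (A : Module.End ℂ SmoothFun) :
    atBase (mulOp a * A) = evalAt basePoint a • atBase A := by
  ext f
  rfl

theorem atBase_y_mul (A : Module.End ℂ SmoothFun) : atBase (y * A) = atBase A := by
  have h : evalAt basePoint coordY = 1 := by
    change ((UpperHalfPlane.I.im : ℝ) : ℂ) = 1
    simp
  rw [y, atBase_mulOp_mul, h, one_smul]

theorem atBase_y_pow_mul (k : ℕ) (A : Module.End ℂ SmoothFun) : atBase (y ^ k * A) = atBase A := by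
  induction k with
  | zero => rw [pow_zero, one_mul]
  | succ k ih => rw [pow_succ', mul_assoc, atBase_y_mul, ih]

theorem exists_smul_basePoint (p : ℍ × ℂ) : ∃ g : JacobiGroup, g • basePoint = p := by
  have hy : 0 < p.1.im := p.1.im_pos
  have hs : Real.sqrt p.1.im ≠ 0 := (Real.sqrt_pos.2 hy).ne'
  have hsC : (Real.sqrt p.1.im : ℂ) ≠ 0 := by exact_mod_cast hs
  have hsq : (Real.sqrt p.1.im : ℂ) * Real.sqrt p.1.im = p.1.im := by
    exact_mod_cast Real.mul_self_sqrt hy.le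
  -- With b = 0 the automorphy factor is the constant y^(-1/2). The remaining entries solve (dτ -
  -- c)/a = x + iy and (α₁τ + α₂)/a = z at τ = i.
  refine ⟨⟨⟨!![(Real.sqrt p.1.im)⁻¹, 0; -(p.1.re / Real.sqrt p.1.im), Real.sqrt p.1.im], ?_⟩,
    !![p.2.im / Real.sqrt p.1.im, p.2.re / Real.sqrt p.1.im]⟩, ?_⟩
  · rw [Matrix.det_fin_two_of]
    field_simp
    simp
  · refine Prod.ext (UpperHalfPlane.ext ?_) ?_
    · rw [JacobiGroup.smul_fst]
      simp [JacobiGroup.factor, basePoint]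
      rw [add_mul, mul_right_comm, hsq, div_mul_cancel₀ _ hsC, add_comm]
      have := Complex.re_add_im (p.1 : ℂ)
      simpa using this
    · rw [JacobiGroup.smul_snd]
      simp [JacobiGroup.factor, basePoint]
      rw [add_mul, mul_right_comm, div_mul_cancel₀ _ hsC, div_mul_cancel₀ _ hsC, add_comm]
      exact Complex.re_add_im p.2

/-- By transitivity, the value at any point is a value at the base point of a translated function.
-/
theorem eq_of_atBase_eq {A B : Module.End ℂ SmoothFun} (hA : IsInvariant A) (hB : IsInvariant B)
    (h : atBase A = atBase B) : A = B := by
  ext1 f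
  refine smoothFun_ext fun p => ?_
  obtain ⟨g, rfl⟩ := exists_smul_basePoint p
  rw [← translate_apply, ← translate_apply, ← hA, ← hB, ← atBase_apply, ← atBase_apply, h]

/-- The element of infinite order `(cos 1, -sin 1; sin 1, cos 1)` of the stabilizer of the base
point. -/
def rotation : JacobiGroup :=
  ⟨⟨!![Real.cos 1, -Real.sin 1; Real.sin 1, Real.cos 1], by
    rw [Matrix.det_fin_two_of]
    have := Real.sin_sq_add_cos_sq 1
    linarith⟩, 0⟩

theorem factor_rotation : rotation.factor (UpperHalfPlane.I : ℂ) = Complex.exp Complex.I := by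
  have h := Complex.exp_mul_I 1
  rw [one_mul] at h
  rw [h]
  simp [rotation, JacobiGroup.factor]
  ring

theorem rotation_smul_basePoint : rotation • basePoint = basePoint := by
  have h1 := rotation.factor_ne_zero UpperHalfPlane.I.im_pos
  refine Prod.ext (UpperHalfPlane.ext ?_) ?_
  · rw [JacobiGroup.smul_fst]
    change _ / rotation.factor (UpperHalfPlane.I : ℂ) = (UpperHalfPlane.I : ℂ)
    rw [div_eq_iff h1]
    simp [rotation, JacobiGroup.factor, basePoint]
    linear_combination (-Complex.sin 1) * Complex.I_mul_I
  · rw [JacobiGroup.smul_snd]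
    simp [rotation, basePoint]

/-! ### The stabilizer acting on functionals at the base point -/

theorem evalAt_zpow (p : ℍ × ℂ) (u : SmoothFunˣ) (n : ℤ) :
    evalAt p ↑(u ^ n) = (evalAt p ↑u) ^ n := by
  have h := congrArg Units.val (map_zpow (Units.map (evalAt p : SmoothFun →* ℂ)) u n)
  rw [Units.val_zpow_eq_zpow_val] at h
  exact h

/-- At the base point j has modulus 1, so j̄ = j⁻¹ and only the difference q - p survives. -/
theorem evalAt_autFactor_rotation (p q : ℤ) :
    evalAt basePoint ↑(autFactor rotation p q) = Complex.exp Complex.I ^ (q - p) := by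
  have h1 : evalAt basePoint ↑(factorUnit rotation) = Complex.exp Complex.I := factor_rotation
  have h2 : evalAt basePoint ↑(factorUnit' rotation) = (Complex.exp Complex.I)⁻¹ := by
    change (starRingEnd ℂ) (rotation.factor (UpperHalfPlane.I : ℂ)) = _
    rw [factor_rotation, ← Complex.exp_conj, Complex.conj_I, Complex.exp_neg]
  rw [autFactor, Units.val_mul, map_mul, evalAt_zpow, evalAt_zpow, h1, h2, inv_zpow', neg_neg,
    ← zpow_add₀ (Complex.exp_ne_zero _)]
  congr 1
  ring

/-- Precomposition with the rotation, on functionals. -/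
def rotate : Module.End ℂ (SmoothFun →ₗ[ℂ] ℂ) := LinearMap.lcomp ℂ ℂ (translate rotation)

theorem rotate_atBase {p q : ℤ} {A : Module.End ℂ SmoothFun} (h : HasWeight p q A) :
    rotate (atBase A) = Complex.exp Complex.I ^ (q - p) • atBase A := by
  ext f
  change (A (translate rotation f) : ℍ × ℂ → ℂ) basePoint = _
  rw [h, ← evalAt_apply, map_mul, evalAt_autFactor_rotation, evalAt_apply, translate_apply,
    rotation_smul_basePoint]
  rfl

/-- Since π is irrational, the rotation by angle 1 has infinite order, so this one element separates
weight difference zero from all others. -/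
theorem exp_I_zpow_ne_one {n : ℤ} (hn : n ≠ 0) : Complex.exp Complex.I ^ n ≠ 1 := by
  rw [← Complex.exp_int_mul, Ne, Complex.exp_eq_one_iff]
  rintro ⟨k, hk⟩
  have h1 : (n : ℂ) = k * (2 * Real.pi) := by
    apply mul_right_cancel₀ Complex.I_ne_zero
    linear_combination hk
  have h2 : (n : ℝ) = k * (2 * Real.pi) := by exact_mod_cast h1
  have hk0 : k ≠ 0 := by
    rintro rfl
    simp at h2
    exact hn h2
  apply irrational_pi
  refine ⟨(n : ℚ) / (2 * k), ?_⟩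
  push_cast
  rw [h2]
  have : (k : ℝ) ≠ 0 := by exact_mod_cast hk0
  field_simp

/-- The span of the monomials of degree at most `n` and weight zero under the stabilizer of the
base point. -/
def balancedSpan (n : ℕ) : Submodule ℂ (Module.End ℂ SmoothFun) :=
  Submodule.span ℂ {u | ∃ a b c d : ℕ, a + b + c + d ≤ n ∧ 2 * a + c = 2 * b + d ∧
    u = mono a b c d}

/-- The functional of an invariant operator is fixed by the rotation, as are those of balanced
monomials. Unbalanced monomials give eigenvectors with eigenvalue other than 1. Eigenspaces are
independent, so the unbalanced part of the functional vanishes. -/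
theorem exists_balanced {n : ℕ} {A u : Module.End ℂ SmoothFun} (hA : IsInvariant A)
    (hu : u ∈ monoSpan n) (h : atBase A = atBase u) :
    ∃ w ∈ balancedSpan n, atBase A = atBase w := by
  have key : ∃ w ∈ balancedSpan n, rotate (atBase w) = atBase w ∧
      ∃ l ∈ ⨆ (μ : ℂ) (_ : μ ≠ 1), rotate.eigenspace μ, atBase u = atBase w + l := by
    clear h
    induction hu using Submodule.span_induction with
    | zero => exact ⟨0, zero_mem _, by simp [atBase_zero], 0, zero_mem _, by simp⟩
    | add x z _ _ hx hz =>
      obtain ⟨w, hw, h1, l, hl, h2⟩ := hx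
      obtain ⟨w', hw', h1', l', hl', h2'⟩ := hz
      refine ⟨w + w', add_mem hw hw', by rw [atBase_add, map_add, h1, h1'], l + l',
        add_mem hl hl', ?_⟩
      rw [atBase_add, atBase_add, h2, h2', add_add_add_comm]
    | smul r x _ hx =>
      obtain ⟨w, hw, h1, l, hl, h2⟩ := hx
      refine ⟨r • w, Submodule.smul_mem _ _ hw, by rw [atBase_smul, map_smul, h1], r • l,
        Submodule.smul_mem _ _ hl, ?_⟩
      rw [atBase_smul, atBase_smul, h2, smul_add]
    | mem x hx =>
      obtain ⟨a, b, c, d, hn, rfl⟩ := hx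
      have hr := rotate_atBase (hasWeight_mono a b c d)
      by_cases hw : 2 * a + c = 2 * b + d
      · refine ⟨mono a b c d, Submodule.subset_span ⟨a, b, c, d, hn, hw, rfl⟩, ?_, 0,
          zero_mem _, by rw [add_zero]⟩
        rw [hr, show ((d : ℤ) + b - a - (c - b + a)) = 0 by omega, zpow_zero, one_smul]
      · refine ⟨0, zero_mem _, by rw [atBase_zero, map_zero], atBase (mono a b c d), ?_,
          by rw [atBase_zero, zero_add]⟩
        have hne := exp_I_zpow_ne_one
          (show ((d : ℤ) + b - a - (c - b + a)) ≠ 0 by omega)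
        exact Submodule.mem_iSup_of_mem _ (Submodule.mem_iSup_of_mem hne
          (Module.End.mem_eigenspace_iff.2 hr))
  obtain ⟨w, hw, h1, l, hl, h2⟩ := key
  refine ⟨w, hw, ?_⟩
  have hA' : rotate (atBase A) = atBase A := by
    simpa using rotate_atBase (hasWeight_zero_iff.2 hA)
  have hl1 : l ∈ rotate.eigenspace 1 := by
    rw [Module.End.mem_eigenspace_iff, one_smul]
    have h3 : l = atBase A - atBase w := by rw [h, h2, add_sub_cancel_left]
    rw [h3, map_sub, hA', h1]
  have hdis := (Module.End.eigenspaces_iSupIndep rotate) 1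
  have hl0 : l = 0 := (Submodule.disjoint_def.1 hdis) l hl1 hl
  rw [h, h2, hl0, add_zero]

/-! ### Invariant operators with values in the filtered algebra at the base point -/

/-- The invariant operator attached to a monomial of weight zero. -/
def invMono (a b c d : ℕ) : Module.End ℂ SmoothFun := y ^ ((c + d) / 2) * mono a b c d

theorem HasWeight.y_pow_mul {p q : ℤ} {A : Module.End ℂ SmoothFun} (h : HasWeight p q A) (k : ℕ) :
    HasWeight (p - k) (q - k) (y ^ k * A) := by
  induction k with
  | zero => simpa using h
  | succ k ih =>
    rw [pow_succ', mul_assoc]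
    convert ih.y_mul using 1 <;> push_cast <;> ring

/-- The two components of the weight of `mono` add up to c + d and are equal in the balanced case,
so the division by 2 is exact and the power of y cancels the weight. -/
theorem isInvariant_invMono {a b c d : ℕ} (h : 2 * a + c = 2 * b + d) :
    IsInvariant (invMono a b c d) := by
  rw [← hasWeight_zero_iff]
  have hw := (hasWeight_mono a b c d).y_pow_mul ((c + d) / 2)
  rwa [show (c - b + a - ((c + d) / 2 : ℕ) : ℤ) = 0 by omega,
    show (d + b - a - ((c + d) / 2 : ℕ) : ℤ) = 0 by omega] at hw

theorem exists_mul_y_pow_eq {n : ℕ} {u : Module.End ℂ SmoothFun} (hu : u ∈ frameSpan ^ n) (k : ℕ) :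
    ∃ w, u * y ^ k = y ^ k * w ∧ EqModLower frameSpan n w u := by
  induction k with
  | zero => exact ⟨u, by simp, .refl _⟩
  | succ k ih =>
    obtain ⟨w, h1, h2⟩ := ih
    obtain ⟨w', h1', h2'⟩ := exists_mul_y_eq (h2.mem_pow one_mem_frameSpan hu)
    exact ⟨w', by rw [pow_succ, ← mul_assoc, h1, mul_assoc, h1', mul_assoc], h2'.trans h2⟩

/-- Moving the inner power of y to the left changes only terms of lower degree, and at the base
point all powers of y become 1. -/
theorem atBase_invMono_mul (a b c d a' b' c' d' : ℕ) :
    ∃ r ∈ lowerPart frameSpan (a + b + c + d + (a' + b' + c' + d')),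
      atBase (invMono a b c d * invMono a' b' c' d') =
        atBase (invMono (a + a') (b + b') (c + c') (d + d')) + atBase r := by
  obtain ⟨w, h1, h2⟩ := exists_mul_y_pow_eq (mono_mem a b c d) ((c' + d') / 2)
  obtain ⟨r, hr, h⟩ := eqModLower_mono_mul (h2.trans (mono_eqModLower a b c d))
    (mono_eqModLower a' b' c' d')
  refine ⟨r, hr, ?_⟩
  rw [invMono, invMono, invMono, mul_assoc, ← mul_assoc (mono a b c d), h1, mul_assoc,
    atBase_y_pow_mul, atBase_y_pow_mul, h, atBase_add, atBase_y_pow_mul]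

/-- The algebra generated by the four operators. -/
def generated : Subalgebra ℂ (Module.End ℂ SmoothFun) :=
  Algebra.adjoin ℂ {opD, opPsi, opD₁, opD₂}

theorem invMono_opD : invMono 1 1 0 0 = opD := by
  simp [invMono, mono, lowMono, opD_eq]

theorem invMono_opPsi : invMono 0 0 1 1 = opPsi := by
  simp [invMono, mono, lowMono, opPsi_eq, mul_assoc]

theorem invMono_opP : invMono 0 1 2 0 = opP := by
  simp [invMono, mono, lowMono, opP, mul_assoc]

theorem invMono_opP' : invMono 1 0 0 2 = opP' := by
  simp [invMono, mono, lowMono, opP', mul_assoc]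

theorem opD_mem_generated : opD ∈ generated := Algebra.subset_adjoin (by simp)
theorem opPsi_mem_generated : opPsi ∈ generated := Algebra.subset_adjoin (by simp)
theorem opD₁_mem_generated : opD₁ ∈ generated := Algebra.subset_adjoin (by simp)
theorem opD₂_mem_generated : opD₂ ∈ generated := Algebra.subset_adjoin (by simp)

theorem opP_mem_generated : opP ∈ generated := by
  have h : opP = (-1 : ℂ) • opD₂ + ((-Complex.I) • opD₁ + Complex.I • opPsi) := by
    rw [opP_eq]
    module
  rw [h]
  exact Subalgebra.add_mem _ (Subalgebra.smul_mem _ opD₂_mem_generated _)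
    (Subalgebra.add_mem _ (Subalgebra.smul_mem _ opD₁_mem_generated _)
      (Subalgebra.smul_mem _ opPsi_mem_generated _))

theorem opP'_mem_generated : opP' ∈ generated := by
  have h : opP' = (-1 : ℂ) • opD₂ + (Complex.I • opD₁ + (-Complex.I) • opPsi) := by
    rw [opP'_eq]
    module
  rw [h]
  exact Subalgebra.add_mem _ (Subalgebra.smul_mem _ opD₂_mem_generated _)
    (Subalgebra.add_mem _ (Subalgebra.smul_mem _ opD₁_mem_generated _)
      (Subalgebra.smul_mem _ opPsi_mem_generated _))

/-- Induction on the degree of the value at the base point, with n a strict upper bound. The top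
part is a combination of balanced monomials, each of which factors into generators up to an
invariant operator of lower degree. -/
theorem mem_generated_of_isInvariant {n : ℕ} {A u : Module.End ℂ SmoothFun} (hA : IsInvariant A)
    (hu : u ∈ lowerPart frameSpan n) (h : atBase A = atBase u) : A ∈ generated := by
  induction n generalizing A u with
  | zero =>
    have hA0 : A = 0 := by
      refine eq_of_atBase_eq hA (invariantSubalgebra.zero_mem) ?_
      rw [h, (Submodule.mem_bot ℂ).1 hu]
    rw [hA0]
    exact zero_mem _
  | succ n ih =>
    have hlow : ∀ {a b c d : ℕ}, a + b + c + d < n → 2 * a + c = 2 * b + d →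
        invMono a b c d ∈ generated := fun {a b c d} hn hw =>
      ih (isInvariant_invMono hw) (lowerPart_mono (m := a + b + c + d + 1) one_mem_frameSpan hn
        (mono_mem a b c d)) (atBase_y_pow_mul _ _)
    -- If the second factor is generated and has positive degree, the first has degree below n and
    -- is generated by induction. The product differs from the operator with the summed exponents by
    -- an invariant operator whose value at the base point has lower degree.
    have hmul : ∀ {a b c d a' b' c' d' : ℕ}, invMono a' b' c' d' ∈ generated →
        2 * a + c = 2 * b + d → 2 * a' + c' = 2 * b' + d' → 0 < a' + b' + c' + d' →
        a + b + c + d + (a' + b' + c' + d') ≤ n →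
        invMono (a + a') (b + b') (c + c') (d + d') ∈ generated := by
      intro a b c d a' b' c' d' hmem hw hw' hpos hn
      have hprod := Subalgebra.mul_mem _ (hlow (a := a) (b := b) (c := c) (d := d) (by omega) hw)
        hmem
      have hinv : IsInvariant (invMono a b c d * invMono a' b' c' d') :=
        invariantSubalgebra.mul_mem (isInvariant_invMono hw) (isInvariant_invMono hw')
      have hinv' : IsInvariant (invMono (a + a') (b + b') (c + c') (d + d')) :=
        isInvariant_invMono (by omega)
      obtain ⟨r, hr, h⟩ := atBase_invMono_mul a b c d a' b' c' d'
      have hdiff : invMono (a + a') (b + b') (c + c') (d + d') +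
          (-1 : ℂ) • (invMono a b c d * invMono a' b' c' d') ∈ generated := by
        refine ih (u := (-1 : ℂ) • r) (invariantSubalgebra.add_mem hinv'
          (invariantSubalgebra.smul_mem hinv _))
          (Submodule.smul_mem _ _ (lowerPart_mono one_mem_frameSpan hn hr)) ?_
        rw [atBase_add, atBase_smul, atBase_smul, h]
        module
      have e : invMono (a + a') (b + b') (c + c') (d + d') =
          (invMono (a + a') (b + b') (c + c') (d + d') +
          (-1 : ℂ) • (invMono a b c d * invMono a' b' c' d')) +
          invMono a b c d * invMono a' b' c' d' := by
        module
      rw [e]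
      exact Subalgebra.add_mem _ hdiff hprod
    have hall : ∀ {a b c d : ℕ}, a + b + c + d ≤ n → 2 * a + c = 2 * b + d →
        invMono a b c d ∈ generated := by
      intro a b c d hn hw
      by_cases h1 : 0 < a ∧ 0 < b
      · have := hmul (a := a - 1) (b := b - 1) (c := c) (d := d)
          (invMono_opD ▸ opD_mem_generated) (by omega) (by omega) (by omega) (by omega)
        rwa [Nat.sub_add_cancel h1.1, Nat.sub_add_cancel h1.2] at this
      by_cases h2 : 0 < c ∧ 0 < d
      · have := hmul (a := a) (b := b) (c := c - 1) (d := d - 1)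
          (invMono_opPsi ▸ opPsi_mem_generated) (by omega) (by omega) (by omega) (by omega)
        rwa [Nat.sub_add_cancel h2.1, Nat.sub_add_cancel h2.2] at this
      by_cases h3 : 0 < b ∧ 1 < c
      · have := hmul (a := a) (b := b - 1) (c := c - 2) (d := d)
          (invMono_opP ▸ opP_mem_generated) (by omega) (by omega) (by omega) (by omega)
        rwa [Nat.sub_add_cancel h3.1, Nat.sub_add_cancel h3.2] at this
      by_cases h4 : 0 < a ∧ 1 < d
      · have := hmul (a := a - 1) (b := b) (c := c) (d := d - 2)
          (invMono_opP' ▸ opP'_mem_generated) (by omega) (by omega) (by omega) (by omega)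
        rwa [Nat.sub_add_cancel h4.1, Nat.sub_add_cancel h4.2] at this
      -- If none of the four generators can be split off, then ab = cd = 0. By balance, a > 0 would
      -- force d ≥ 2, b > 0 would force c ≥ 2, and a = b = 0 forces c = d = 0.
      obtain ⟨rfl, rfl, rfl, rfl⟩ : a = 0 ∧ b = 0 ∧ c = 0 ∧ d = 0 := by omega
      have e : invMono 0 0 0 0 = 1 := by simp [invMono, mono_zero]
      rw [e]
      exact Subalgebra.one_mem _
    obtain ⟨w, hw, hAw⟩ := exists_balanced hA (frameSpan_pow_le n hu) h
    have key : ∃ B, IsInvariant B ∧ B ∈ generated ∧ atBase B = atBase w := by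
      clear hAw
      induction hw using Submodule.span_induction with
      | zero => exact ⟨0, invariantSubalgebra.zero_mem, zero_mem _, rfl⟩
      | add x z _ _ hx hz =>
        obtain ⟨B, h1, h2, h3⟩ := hx
        obtain ⟨B', h1', h2', h3'⟩ := hz
        exact ⟨B + B', invariantSubalgebra.add_mem h1 h1', Subalgebra.add_mem _ h2 h2', by
          rw [atBase_add, atBase_add, h3, h3']⟩
      | smul r x _ hx =>
        obtain ⟨B, h1, h2, h3⟩ := hx
        exact ⟨r • B, invariantSubalgebra.smul_mem h1 r, Subalgebra.smul_mem _ h2 r, by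
          rw [atBase_smul, atBase_smul, h3]⟩
      | mem x hx =>
        obtain ⟨a, b, c, d, hn, hw, rfl⟩ := hx
        exact ⟨invMono a b c d, isInvariant_invMono hw, hall hn hw, atBase_y_pow_mul _ _⟩
    obtain ⟨B, hB, hBg, hBw⟩ := key
    rw [eq_of_atBase_eq hA hB (hAw.trans hBw.symm)]
    exact hBg

/-! ### Modules of operators -/

/-- The operators which map `T` to itself by left multiplication. -/
def leftStabilizer (T : Submodule ℂ (Module.End ℂ SmoothFun)) :
    Subalgebra ℂ (Module.End ℂ SmoothFun) where
  carrier := {A | ∀ t ∈ T, A * t ∈ T}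
  mul_mem' {A B} hA hB t ht := by
    rw [mul_assoc]
    exact hA _ (hB _ ht)
  add_mem' {A B} hA hB t ht := by
    rw [add_mul]
    exact add_mem (hA _ ht) (hB _ ht)
  algebraMap_mem' c t ht := by
    rw [Algebra.algebraMap_eq_smul_one, smul_mul_assoc, one_mul]
    exact Submodule.smul_mem _ _ ht

theorem mem_leftStabilizer_span {s : Set (Module.End ℂ SmoothFun)} {A : Module.End ℂ SmoothFun}
    (h : ∀ t ∈ s, A * t ∈ Submodule.span ℂ s) : A ∈ leftStabilizer (Submodule.span ℂ s) := by
  intro t ht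
  induction ht using Submodule.span_induction with
  | zero => rw [mul_zero]; exact zero_mem _
  | add x z _ _ hx hz => rw [mul_add]; exact add_mem hx hz
  | smul r x _ hx => rw [mul_smul_comm]; exact Submodule.smul_mem _ _ hx
  | mem x hx => exact h x hx

theorem mulOp_mul (a b : SmoothFun) : mulOp a * mulOp b = mulOp (a * b) := by
  ext1 f
  exact (mul_assoc a b f).symm

theorem mul_mulOp {δ : Module.End ℂ SmoothFun} (hδ : ∀ f g, δ (f * g) = δ f * g + f * δ g)
    (a : SmoothFun) (B : Module.End ℂ SmoothFun) :
    δ * (mulOp a * B) = mulOp (δ a) * B + mulOp a * (δ * B) := by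
  ext1 f
  exact hδ a (B f)

theorem opW_eq_add : opW = du + (-Complex.I) • dv := by
  rw [opW]
  module

theorem opE_eq_add : opE = y * (dx + (-Complex.I) • dy) + v * opW := by
  rw [opE, opW]
  congr 2
  module

theorem opE'_eq_add : opE' = y * (dx + Complex.I • dy) + v * opW' := rfl

theorem du_eq : du = (1 / 2 : ℂ) • (opW + opW') := by
  rw [opW, opW']
  module

theorem dv_eq : dv = (Complex.I / 2) • (opW + (-1 : ℂ) • opW') := by
  rw [opW, opW']
  match_scalars
  · ring_nf
    norm_num
  · ring_nf

theorem unitY_inv_mul : (↑unitY⁻¹ : SmoothFun) * coordY = 1 := unitY.inv_mul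

/-- The frame can be inverted over the smooth functions because y is a unit. -/
theorem dx_eq : dx = (1 / 2 : ℂ) • (mulOp ↑unitY⁻¹ * (opE + opE' +
    (-1 : ℂ) • (v * (opW + opW')))) := by
  have h2 : algebraMap ℂ SmoothFun (1 / 2) * 2 = 1 := by
    rw [← map_ofNat (algebraMap ℂ SmoothFun), ← map_mul]
    norm_num
  ext1 f
  simp only [LinearMap.smul_apply, Module.End.mul_apply, LinearMap.add_apply, neg_one_smul,
    mulOp_apply, v_apply, opE_apply, opE'_apply, opW_apply, opW'_apply]
  rw [Algebra.smul_def]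
  linear_combination (-dx f) * h2 -
    (algebraMap ℂ SmoothFun (1 / 2) * 2 * dx f) * unitY_inv_mul

theorem dy_eq : dy = (Complex.I / 2) • (mulOp ↑unitY⁻¹ * (opE + (-1 : ℂ) • opE' +
    (-1 : ℂ) • (v * (opW + (-1 : ℂ) • opW')))) := by
  have h2 : algebraMap ℂ SmoothFun (Complex.I / 2) * 2 * imUnit = -1 := by
    rw [← map_ofNat (algebraMap ℂ SmoothFun), imUnit, ← map_mul, ← map_mul, div_mul_cancel₀ _
      two_ne_zero, Complex.I_mul_I, map_neg, map_one]
  ext1 f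
  simp only [LinearMap.smul_apply, Module.End.mul_apply, LinearMap.add_apply, neg_one_smul,
    mulOp_apply, v_apply, opE_apply, opE'_apply, opW_apply, opW'_apply]
  rw [Algebra.smul_def]
  linear_combination dy f * h2 +
    (algebraMap ℂ SmoothFun (Complex.I / 2) * 2 * imUnit * dy f) * unitY_inv_mul

/-- The algebra generated by the frame. -/
def frameAlgebra : Subalgebra ℂ (Module.End ℂ SmoothFun) :=
  Algebra.adjoin ℂ {opE, opE', opW, opW'}

/-- The operators with smooth coefficients with respect to the frame. -/
def frameModule : Submodule ℂ (Module.End ℂ SmoothFun) :=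
  Submodule.span ℂ {t | ∃ a : SmoothFun, ∃ u ∈ frameAlgebra, t = mulOp a * u}

theorem frame_mem_leftStabilizer {δ : Module.End ℂ SmoothFun}
    (hδ : ∀ f g, δ (f * g) = δ f * g + f * δ g) (h : δ ∈ frameAlgebra) :
    δ ∈ leftStabilizer frameModule := by
  refine mem_leftStabilizer_span ?_
  rintro _ ⟨a, u, hu, rfl⟩
  rw [mul_mulOp hδ]
  exact add_mem (Submodule.subset_span ⟨_, u, hu, rfl⟩)
    (Submodule.subset_span ⟨_, _, Subalgebra.mul_mem _ h hu, rfl⟩)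

theorem mulOp_mem_leftStabilizer (b : SmoothFun) : mulOp b ∈ leftStabilizer frameModule := by
  refine mem_leftStabilizer_span ?_
  rintro _ ⟨a, u, hu, rfl⟩
  rw [← mul_assoc, mulOp_mul]
  exact Submodule.subset_span ⟨_, u, hu, rfl⟩

/-- The stabilizer of a module is an algebra, so it is enough that it contains the four partial
derivatives. Applying their product to 1 gives the claim without normal ordering. -/
theorem partials_mem_frameModule (i j k l : ℕ) :
    dx ^ i * dy ^ j * du ^ k * dv ^ l ∈ frameModule := by
  have hE := frame_mem_leftStabilizer opE_mul (Algebra.subset_adjoin (by simp))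
  have hE' := frame_mem_leftStabilizer opE'_mul (Algebra.subset_adjoin (by simp))
  have hW := frame_mem_leftStabilizer opW_mul (Algebra.subset_adjoin (by simp))
  have hW' := frame_mem_leftStabilizer opW'_mul (Algebra.subset_adjoin (by simp))
  have hv : v ∈ leftStabilizer frameModule := mulOp_mem_leftStabilizer _
  have hdu : du ∈ leftStabilizer frameModule := by
    rw [du_eq]
    exact Subalgebra.smul_mem _ (Subalgebra.add_mem _ hW hW') _
  have hW'' := Subalgebra.add_mem _ hW (Subalgebra.smul_mem _ hW' (-1))
  have hdv : dv ∈ leftStabilizer frameModule := by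
    rw [dv_eq]
    exact Subalgebra.smul_mem _ hW'' _
  have hdx : dx ∈ leftStabilizer frameModule := by
    rw [dx_eq]
    exact Subalgebra.smul_mem _ (Subalgebra.mul_mem _ (mulOp_mem_leftStabilizer _)
      (Subalgebra.add_mem _ (Subalgebra.add_mem _ hE hE') (Subalgebra.smul_mem _
        (Subalgebra.mul_mem _ hv (Subalgebra.add_mem _ hW hW')) _))) _
  have hdy : dy ∈ leftStabilizer frameModule := by
    rw [dy_eq]
    exact Subalgebra.smul_mem _ (Subalgebra.mul_mem _ (mulOp_mem_leftStabilizer _)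
      (Subalgebra.add_mem _ (Subalgebra.add_mem _ hE (Subalgebra.smul_mem _ hE' _))
        (Subalgebra.smul_mem _ (Subalgebra.mul_mem _ hv hW'') _))) _
  have h := Subalgebra.mul_mem _ (Subalgebra.mul_mem _ (Subalgebra.mul_mem _
    (Subalgebra.pow_mem _ hdx i) (Subalgebra.pow_mem _ hdy j)) (Subalgebra.pow_mem _ hdu k))
    (Subalgebra.pow_mem _ hdv l)
  have h1 : (1 : Module.End ℂ SmoothFun) ∈ frameModule :=
    Submodule.subset_span ⟨1, 1, Subalgebra.one_mem _, by ext1 f; exact (one_mul f).symm⟩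
  simpa using h 1 h1

theorem exists_mem_pow_of_mem_frameAlgebra {u : Module.End ℂ SmoothFun} (hu : u ∈ frameAlgebra) :
    ∃ n, u ∈ frameSpan ^ n := by
  induction hu using Algebra.adjoin_induction with
  | mem x hx =>
    refine ⟨1, ?_⟩
    rw [pow_one]
    exact Submodule.subset_span (Set.mem_insert_of_mem _ hx)
  | algebraMap r => exact ⟨0, by rw [pow_zero, Submodule.mem_one]; exact ⟨r, rfl⟩⟩
  | add x z _ _ hx hz =>
    obtain ⟨m, hm⟩ := hx
    obtain ⟨n, hn⟩ := hz
    exact ⟨max m n, add_mem (pow_mono_of_one_mem one_mem_frameSpan (le_max_left _ _) hm)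
      (pow_mono_of_one_mem one_mem_frameSpan (le_max_right _ _) hn)⟩
  | mul x z _ _ hx hz =>
    obtain ⟨m, hm⟩ := hx
    obtain ⟨n, hn⟩ := hz
    exact ⟨m + n, pow_mul_mem hm hn⟩

theorem exists_frameAlgebra_of_mem_frameModule {A : Module.End ℂ SmoothFun}
    (hA : A ∈ frameModule) : ∃ u ∈ frameAlgebra, atBase A = atBase u := by
  induction hA using Submodule.span_induction with
  | zero => exact ⟨0, zero_mem _, rfl⟩
  | add x z _ _ hx hz =>
    obtain ⟨u, hu, h⟩ := hx
    obtain ⟨u', hu', h'⟩ := hz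
    exact ⟨u + u', Subalgebra.add_mem _ hu hu', by rw [atBase_add, atBase_add, h, h']⟩
  | smul r x _ hx =>
    obtain ⟨u, hu, h⟩ := hx
    exact ⟨r • u, Subalgebra.smul_mem _ hu r, by rw [atBase_smul, atBase_smul, h]⟩
  | mem x hx =>
    obtain ⟨a, u, hu, rfl⟩ := hx
    exact ⟨evalAt basePoint a • u, Subalgebra.smul_mem _ hu _, by
      rw [atBase_mulOp_mul, atBase_smul]⟩

/-! ### Comparison with differential operators -/

theorem mem_generated_of_mem_invariantDiffOps {A : Module.End ℂ SmoothFun}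
    (hA : A ∈ invariantDiffOps) : A ∈ generated := by
  obtain ⟨hD, hI⟩ := hA
  obtain ⟨U, -, hU, N, a, -, h⟩ := hD basePoint
  -- The local coefficients are frozen at their values at the base point, which gives a global
  -- operator with the same functional there.
  have hmem : (∑ i : Fin N, ∑ j : Fin N, ∑ k : Fin N, ∑ l : Fin N, a i j k l basePoint •
      (dx ^ (i : ℕ) * dy ^ (j : ℕ) * du ^ (k : ℕ) * dv ^ (l : ℕ))) ∈ frameModule :=
    Submodule.sum_mem _ fun i _ => Submodule.sum_mem _ fun j _ => Submodule.sum_mem _ fun k _ =>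
      Submodule.sum_mem _ fun l _ => Submodule.smul_mem _ _ (partials_mem_frameModule i j k l)
  obtain ⟨u, hu, hAu⟩ := exists_frameAlgebra_of_mem_frameModule hmem
  obtain ⟨n, hn⟩ := exists_mem_pow_of_mem_frameAlgebra hu
  refine mem_generated_of_isInvariant (n := n + 1) hI hn ?_
  rw [← hAu]
  ext f
  rw [atBase_apply, h f basePoint hU, atBase_apply, ← evalAt_apply]
  simp only [LinearMap.sum_apply, LinearMap.smul_apply, map_sum, map_smul, evalAt_apply,
    smul_eq_mul]

/-- The operators with smooth coefficients with respect to the coordinates. -/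
def partialsModule : Submodule ℂ (Module.End ℂ SmoothFun) :=
  Submodule.span ℂ {t | ∃ (a : SmoothFun) (i j k l : ℕ),
    t = mulOp a * (dx ^ i * dy ^ j * du ^ k * dv ^ l)}

theorem partial_mem_leftStabilizer {δ : Module.End ℂ SmoothFun}
    (hδ : ∀ f g, δ (f * g) = δ f * g + f * δ g)
    (h : ∀ i j k l : ℕ, ∃ i' j' k' l' : ℕ, δ * (dx ^ i * dy ^ j * du ^ k * dv ^ l) =
      dx ^ i' * dy ^ j' * du ^ k' * dv ^ l') : δ ∈ leftStabilizer partialsModule := by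
  refine mem_leftStabilizer_span ?_
  rintro _ ⟨a, i, j, k, l, rfl⟩
  obtain ⟨i', j', k', l', h⟩ := h i j k l
  rw [mul_mulOp hδ, h]
  exact add_mem (Submodule.subset_span ⟨_, _, _, _, _, rfl⟩)
    (Submodule.subset_span ⟨_, _, _, _, _, rfl⟩)

/-- The stabilizer device again, now with commuting partial derivatives: a derivation applied to
a·∂^α gives two terms of the same shape. -/
theorem generated_le_partialsModule {A : Module.End ℂ SmoothFun} (hA : A ∈ generated) :
    A ∈ partialsModule := by
  have cyx : Commute dy dx := LinearMap.ext dy_dx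
  have cux : Commute du dx := LinearMap.ext du_dx
  have cvx : Commute dv dx := LinearMap.ext dv_dx
  have cuy : Commute du dy := LinearMap.ext du_dy
  have cvy : Commute dv dy := LinearMap.ext dv_dy
  have cvu : Commute dv du := LinearMap.ext dv_du
  have hx : dx ∈ leftStabilizer partialsModule := by
    refine partial_mem_leftStabilizer dx_mul fun i j k l => ⟨i + 1, j, k, l, ?_⟩
    rw [pow_succ']
    simp only [mul_assoc]
  have hy : dy ∈ leftStabilizer partialsModule := by
    refine partial_mem_leftStabilizer dy_mul fun i j k l => ⟨i, j + 1, k, l, ?_⟩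
    rw [pow_succ']
    simp only [← mul_assoc]
    rw [(cyx.pow_right i).eq]
  have hu : du ∈ leftStabilizer partialsModule := by
    refine partial_mem_leftStabilizer du_mul fun i j k l => ⟨i, j, k + 1, l, ?_⟩
    rw [← mul_assoc, ← mul_assoc du, ((cux.pow_right i).mul_right (cuy.pow_right j)).eq, pow_succ']
    simp only [mul_assoc]
  have hv : dv ∈ leftStabilizer partialsModule := by
    refine partial_mem_leftStabilizer dv_mul fun i j k l => ⟨i, j, k, l + 1, ?_⟩
    rw [← mul_assoc, (((cvx.pow_right i).mul_right (cvy.pow_right j)).mul_right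
      (cvu.pow_right k)).eq, pow_succ']
    simp only [mul_assoc]
  have hm : ∀ b, mulOp b ∈ leftStabilizer partialsModule := by
    intro b
    refine mem_leftStabilizer_span ?_
    rintro _ ⟨a, i, j, k, l, rfl⟩
    rw [← mul_assoc, mulOp_mul]
    exact Submodule.subset_span ⟨_, _, _, _, _, rfl⟩
  have hY : y ∈ leftStabilizer partialsModule := hm _
  have hV : v ∈ leftStabilizer partialsModule := hm _
  have hW : opW ∈ leftStabilizer partialsModule := by
    rw [opW_eq_add]
    exact Subalgebra.add_mem _ hu (Subalgebra.smul_mem _ hv _)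
  have hW' : opW' ∈ leftStabilizer partialsModule :=
    Subalgebra.add_mem _ hu (Subalgebra.smul_mem _ hv _)
  have hE : opE ∈ leftStabilizer partialsModule := by
    rw [opE_eq_add]
    exact Subalgebra.add_mem _ (Subalgebra.mul_mem _ hY
      (Subalgebra.add_mem _ hx (Subalgebra.smul_mem _ hy _))) (Subalgebra.mul_mem _ hV hW)
  have hE' : opE' ∈ leftStabilizer partialsModule := by
    rw [opE'_eq_add]
    exact Subalgebra.add_mem _ (Subalgebra.mul_mem _ hY
      (Subalgebra.add_mem _ hx (Subalgebra.smul_mem _ hy _))) (Subalgebra.mul_mem _ hV hW')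
  have hP : opP ∈ leftStabilizer partialsModule :=
    Subalgebra.mul_mem _ (Subalgebra.mul_mem _ hY hE') (Subalgebra.pow_mem _ hW 2)
  have hP' : opP' ∈ leftStabilizer partialsModule :=
    Subalgebra.mul_mem _ (Subalgebra.mul_mem _ hY hE) (Subalgebra.pow_mem _ hW' 2)
  have hPsi : opPsi ∈ leftStabilizer partialsModule := by
    rw [opPsi_eq]
    exact Subalgebra.mul_mem _ (Subalgebra.mul_mem _ hY hW) hW'
  have hle : generated ≤ leftStabilizer partialsModule := by
    refine Algebra.adjoin_le ?_
    rintro B (rfl | rfl | rfl | rfl)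
    · rw [opD_eq]
      exact Subalgebra.mul_mem _ (Subalgebra.add_mem _ hE
        (Subalgebra.smul_mem _ (Subalgebra.one_mem _) _)) hE'
    · exact hPsi
    · rw [opD₁_eq]
      exact Subalgebra.add_mem _ hPsi (Subalgebra.add_mem _ (Subalgebra.smul_mem _ hP _)
        (Subalgebra.smul_mem _ hP' _))
    · rw [opD₂_eq]
      exact Subalgebra.smul_mem _ (Subalgebra.add_mem _ hP hP') _
  have h1 : (1 : Module.End ℂ SmoothFun) ∈ partialsModule :=
    Submodule.subset_span ⟨1, 0, 0, 0, 0, by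
      simp only [pow_zero, mul_one]
      ext1 f
      exact (one_mul f).symm⟩
  simpa using hle hA 1 h1

theorem isDiffOp_of_mem_partialsModule {A : Module.End ℂ SmoothFun} (hA : A ∈ partialsModule) :
    IsDiffOp A := by
  -- The formula is asked for every large N so that two expressions can be brought to the same
  -- summation range and added.
  have key : ∃ (N₀ : ℕ) (a : ℕ → ℕ → ℕ → ℕ → SmoothFun), ∀ N ≥ N₀, ∀ f, A f =
      ∑ i ∈ Finset.range N, ∑ j ∈ Finset.range N, ∑ k ∈ Finset.range N, ∑ l ∈ Finset.range N,
        a i j k l * (dx ^ i * dy ^ j * du ^ k * dv ^ l) f := by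
    induction hA using Submodule.span_induction with
    | zero => exact ⟨0, 0, fun N _ f => by simp⟩
    | add x z _ _ hx hz =>
      obtain ⟨M, a, ha⟩ := hx
      obtain ⟨N, b, hb⟩ := hz
      refine ⟨max M N, fun i j k l => a i j k l + b i j k l, fun n hn f => ?_⟩
      rw [LinearMap.add_apply, ha n (le_trans (le_max_left _ _) hn),
        hb n (le_trans (le_max_right _ _) hn)]
      simp only [← Finset.sum_add_distrib, add_mul]
    | smul r x _ hx =>
      obtain ⟨M, a, ha⟩ := hx
      refine ⟨M, fun i j k l => r • a i j k l, fun n hn f => ?_⟩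
      rw [LinearMap.smul_apply, ha n hn]
      simp only [Finset.smul_sum, smul_mul_assoc]
    | mem x hx =>
      obtain ⟨a, i, j, k, l, rfl⟩ := hx
      refine ⟨i + j + k + l + 1, fun i' j' k' l' =>
        if i' = i then if j' = j then if k' = k then if l' = l then a else 0 else 0 else 0 else 0,
        fun n hn f => ?_⟩
      rw [Finset.sum_eq_single_of_mem i (Finset.mem_range.2 (by omega)) (fun b _ hb => by simp [hb]),
        Finset.sum_eq_single_of_mem j (Finset.mem_range.2 (by omega)) (fun b _ hb => by simp [hb]),
        Finset.sum_eq_single_of_mem k (Finset.mem_range.2 (by omega)) (fun b _ hb => by simp [hb]),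
        Finset.sum_eq_single_of_mem l (Finset.mem_range.2 (by omega)) (fun b _ hb => by simp [hb])]
      simp [mulOp_apply]
  obtain ⟨N, a, h⟩ := key
  refine fun p => ⟨Set.univ, isOpen_univ, trivial, N, fun i j k l => a i j k l,
    fun i j k l => (a i j k l).2.contMDiffOn, fun f q _ => ?_⟩
  rw [h N le_rfl f, ← evalAt_apply]
  simp only [map_sum, Finset.sum_range, map_mul, evalAt_apply]

theorem invariantDiffOps_eq : invariantDiffOps =
    (Algebra.adjoin ℂ {opD, opPsi, opD₁, opD₂} : Set (Module.End ℂ SmoothFun)) := by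
  ext A
  refine ⟨mem_generated_of_mem_invariantDiffOps, fun hA =>
    ⟨isDiffOp_of_mem_partialsModule (generated_le_partialsModule hA), ?_⟩⟩
  have hle : Algebra.adjoin ℂ {opD, opPsi, opD₁, opD₂} ≤ invariantSubalgebra := by
    refine Algebra.adjoin_le ?_
    rintro B (rfl | rfl | rfl | rfl)
    · exact isInvariant_opD
    · exact isInvariant_opPsi
    · exact isInvariant_opD₁
    · exact isInvariant_opD₂
  exact hle hA

/-! ### The action in real coordinates -/

/-- The real number `λ` in `z = λ τ + μ`. -/
def lamCoord (p : ℍ × ℂ) : ℝ := p.2.im / p.1.im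

/-- The real number `μ` in `z = λ τ + μ`. -/
def muCoord (p : ℍ × ℂ) : ℝ := p.2.re - p.2.im / p.1.im * p.1.re

theorem lamCoord_mul_add_muCoord (p : ℍ × ℂ) :
    (lamCoord p : ℂ) * p.1 + muCoord p = p.2 := by
  have h := p.1.im_pos.ne'
  apply Complex.ext
  · simp [lamCoord, muCoord]
  · simp [lamCoord, muCoord]
    field_simp

theorem real_coords_unique {τ : ℂ} (hτ : τ.im ≠ 0) {a b c d : ℝ}
    (h : (a : ℂ) * τ + b = c * τ + d) : a = c ∧ b = d := by
  have h1 := congrArg Complex.im h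
  have h2 := congrArg Complex.re h
  simp at h1 h2
  have h3 : a = c := h1.resolve_right hτ
  rw [h3] at h2
  exact ⟨h3, by linarith⟩

/-- Translation by α adds α to the coordinates. Dividing by j and re-expanding in gτ and 1 then
applies g. Nothing depends on τ. -/
theorem coords_smul (g : JacobiGroup) (p : ℍ × ℂ) :
    lamCoord (g • p) = g.mat 0 0 * (lamCoord p + g.vec 0 0) + g.mat 0 1 * (muCoord p + g.vec 0 1) ∧
    muCoord (g • p) = g.mat 1 0 * (lamCoord p + g.vec 0 0)
      + g.mat 1 1 * (muCoord p + g.vec 0 1) := by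
  have hj := g.factor_ne_zero p.1.im_pos
  have hd : (g.mat 0 0 : ℂ) * g.mat 1 1 - g.mat 0 1 * g.mat 1 0 = 1 := by
    exact_mod_cast g.det_eq
  refine real_coords_unique (τ := ((g • p).1 : ℂ)) (g • p).1.im_pos.ne' ?_
  rw [lamCoord_mul_add_muCoord, JacobiGroup.smul_snd, JacobiGroup.smul_fst,
    ← lamCoord_mul_add_muCoord p]
  field_simp
  simp only [JacobiGroup.factor]
  push_cast
  linear_combination (-(lamCoord p + g.vec 0 0 : ℂ) * p.1 - (muCoord p + g.vec 0 1)) * hd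

/-- The norm of the difference of the real coordinates of `p` and `q`, with respect to the
quadratic form attached to the first component of `p`. -/
def pairInvariant (p q : ℍ × ℂ) : ℝ :=
  Complex.normSq ((lamCoord p - lamCoord q : ℝ) * (p.1 : ℂ) + (muCoord p - muCoord q : ℝ)) / p.1.im

/-- The translation cancels in the difference of coordinates, the linear form at τ is divided by j,
and y is divided by |j|². -/
theorem pairInvariant_smul (g : JacobiGroup) (p q : ℍ × ℂ) :
    pairInvariant (g • p) (g • q) = pairInvariant p q := by
  have hj := g.factor_ne_zero p.1.im_pos
  have hd : (g.mat 0 0 : ℂ) * g.mat 1 1 - g.mat 0 1 * g.mat 1 0 = 1 := by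
    exact_mod_cast g.det_eq
  have him : (g • p).1.im = p.1.im / Complex.normSq (g.factor p.1) := by
    have h := im_smul_fst g p
    rw [Complex.mul_conj] at h
    exact_mod_cast h
  have hnum : ((lamCoord (g • p) - lamCoord (g • q) : ℝ) * ((g • p).1 : ℂ)
      + (muCoord (g • p) - muCoord (g • q) : ℝ)) =
      ((lamCoord p - lamCoord q : ℝ) * (p.1 : ℂ) + (muCoord p - muCoord q : ℝ))
        / g.factor p.1 := by
    rw [(coords_smul g p).1, (coords_smul g q).1, (coords_smul g p).2, (coords_smul g q).2,
      JacobiGroup.smul_fst]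
    field_simp
    simp only [JacobiGroup.factor]
    push_cast
    linear_combination ((lamCoord p - lamCoord q : ℂ) * p.1 + (muCoord p - muCoord q)) * hd
  have hN : Complex.normSq (g.factor p.1) ≠ 0 := (Complex.normSq_pos.2 hj).ne'
  rw [pairInvariant, pairInvariant, hnum, him, Complex.normSq_div]
  field_simp

theorem eq_of_pairInvariant_eq_zero {p q : ℍ × ℂ} (h : pairInvariant p q = 0) :
    lamCoord p = lamCoord q ∧ muCoord p = muCoord q := by
  rw [pairInvariant, div_eq_zero_iff, or_iff_left p.1.im_pos.ne', Complex.normSq_eq_zero] at h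
  have h1 := real_coords_unique (τ := (p.1 : ℂ)) (c := 0) (d := 0) p.1.im_pos.ne'
    (by rw [h]; simp)
  exact ⟨sub_eq_zero.1 h1.1, sub_eq_zero.1 h1.2⟩

/-- The second components at (i, 0) and (i, 1) differ by 1/j, which determines j at i. All entries
then follow from the independence of i and 1 over ℝ. Faithfulness makes conjugation by the isometry
a homomorphism of the abstract group. -/
theorem jacobiGroup_faithful {g h : JacobiGroup} (H : ∀ p : ℍ × ℂ, g • p = h • p) : g = h := by
  have hg := g.factor_ne_zero UpperHalfPlane.I.im_pos
  have hh := h.factor_ne_zero UpperHalfPlane.I.im_pos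
  have H0 := congrArg Prod.snd (H (UpperHalfPlane.I, 0))
  have H1 := congrArg Prod.snd (H (UpperHalfPlane.I, 1))
  have H2 := congrArg (fun p : ℍ × ℂ => (p.1 : ℂ)) (H (UpperHalfPlane.I, 0))
  simp only [JacobiGroup.smul_fst] at H2
  rw [JacobiGroup.smul_snd, JacobiGroup.smul_snd] at H0 H1
  simp only [zero_add] at H0
  rw [add_assoc, add_assoc, add_div 1 _ (g.factor _), add_div 1 _ (h.factor _), H0, add_left_inj]
    at H1
  have hj : g.factor UpperHalfPlane.I = h.factor UpperHalfPlane.I := by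
    field_simp at H1
    exact H1.symm
  rw [hj, div_left_inj' hh] at H0 H2
  have e1 := real_coords_unique (τ := (UpperHalfPlane.I : ℂ)) UpperHalfPlane.I.im_pos.ne' H0
  have e2 := real_coords_unique (τ := (UpperHalfPlane.I : ℂ)) UpperHalfPlane.I.im_pos.ne'
    (a := g.mat 1 1) (b := -g.mat 1 0) (c := h.mat 1 1) (d := -h.mat 1 0)
    (by simp only [Complex.ofReal_neg]; linear_combination H2)
  have e3 := real_coords_unique (τ := (UpperHalfPlane.I : ℂ)) UpperHalfPlane.I.im_pos.ne'
    (a := -g.mat 0 1) (b := g.mat 0 0) (c := -h.mat 0 1) (d := h.mat 0 0)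
    (by push_cast; exact hj)
  ext i j
  · fin_cases i <;> fin_cases j
    · exact e3.2
    · exact neg_injective e3.1
    · exact neg_injective e2.2
    · exact e2.1
  · fin_cases i
    fin_cases j
    · exact e1.1
    · exact e1.2

/-! ### Automorphisms of the group -/

theorem sq_eq_one_of_commute_conj {h : SL(2, ℝ)}
    (H : ∀ k : SL(2, ℝ), h * (k * h * k⁻¹) = k * h * k⁻¹ * h) : h * h = 1 := by
  obtain ⟨p, q, r, s, hh⟩ : ∃ p q r s, (h : Matrix (Fin 2) (Fin 2) ℝ) = !![p, q; r, s] :=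
    ⟨_, _, _, _, Matrix.eta_fin_two _⟩
  have hd := h.det_coe
  rw [hh, Matrix.det_fin_two_of] at hd
  have key : ∀ k : SL(2, ℝ), (h : Matrix (Fin 2) (Fin 2) ℝ) * (k * h * (k.1).adjugate) =
      k * h * (k.1).adjugate * h := fun k => by
    have := congrArg (fun m : SL(2, ℝ) => (m : Matrix (Fin 2) (Fin 2) ℝ)) (H k)
    simpa only [Matrix.SpecialLinearGroup.coe_mul, Matrix.SpecialLinearGroup.coe_inv] using this
  -- The two elementary unipotent conjugations suffice. Their entries give r² = 0, q² = 0 and (p -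
  -- s)² = 0, so h is scalar and the determinant gives p² = 1.
  have H1 := key ⟨!![1, 1; 0, 1], by simp⟩
  have H2 := key ⟨!![1, 0; 1, 1], by simp⟩
  simp only [hh, Matrix.adjugate_fin_two_of, Matrix.mul_fin_two] at H1 H2
  have A10 := congrFun₂ H1 1 0
  have A01 := congrFun₂ H1 0 1
  have B01 := congrFun₂ H2 0 1
  simp at A10 A01 B01
  have hr : r = 0 := by
    have : r * r = 0 := by linarith
    simpa using this
  have hq : q = 0 := by
    have : q * q = 0 := by linarith
    simpa using this
  subst hr hq
  have hs : p = s := by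
    have : (p - s) * (p - s) = 0 := by linarith
    linarith [mul_self_eq_zero.1 this]
  subst hs
  apply Subtype.ext
  change (h : Matrix (Fin 2) (Fin 2) ℝ) * h = 1
  rw [hh, Matrix.mul_fin_two, Matrix.one_fin_two]
  have hp : p * p = 1 := by linarith
  simp [hp]

/-- Translations commute with all their conjugates, and by surjectivity the same holds for the
matrix part of their images against all of SL(2, ℝ), which therefore squares to 1. Every translation
is the square of another, which removes the sign. -/
theorem mat_eq_one_of_surjective (φ : JacobiGroup →* JacobiGroup) (hφ : Function.Surjective φ)
    {n : JacobiGroup} (hn : n.mat = 1) : (φ n).mat = 1 := by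
  have hcomm : ∀ a b : JacobiGroup, a.mat = 1 → b.mat = 1 → a * b = b * a := by
    intro a b ha hb
    simp [JacobiGroup.mul_def, ha, hb, add_comm]
  let m : JacobiGroup := ⟨1, (1 / 2 : ℝ) • n.vec⟩
  have hm : n = m * m := by
    refine JacobiGroup.ext (by simp [JacobiGroup.mul_def, m, hn]) ?_
    simp only [JacobiGroup.mul_def, m, inv_one, Matrix.SpecialLinearGroup.coe_one,
      Matrix.transpose_one, Matrix.mul_one, ← add_smul]
    norm_num
  rw [hm, map_mul]
  refine sq_eq_one_of_commute_conj fun k => ?_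
  obtain ⟨x, hx⟩ := hφ ⟨k, 0⟩
  have hc : (x * m * x⁻¹).mat = 1 := by
    simp [JacobiGroup.mul_def, JacobiGroup.inv_def, m]
  have h := congrArg (fun g => (φ g).mat) (hcomm m _ rfl hc)
  simp only [map_mul, map_inv, hx] at h
  exact h

/-! ### Failure of weak symmetry -/

theorem not_isWeaklySymmetric :
    ¬ IsWeaklySymmetric (𝓘(ℝ, ℂ).prod 𝓘(ℝ, ℂ)) JacobiGroup (ℍ × ℂ) := by
  rintro ⟨-, r, -, μ, -, h1, h2, -, h3⟩
  choose φ₀ hφ₀ using h1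
  have hφ₁ : ∀ g p, μ (g • p) = φ₀ g • μ p := fun g p => by
    rw [← hφ₀, μ.symm_apply_apply]
  let φ : JacobiGroup →* JacobiGroup := MonoidHom.mk' φ₀ fun a b => jacobiGroup_faithful fun p => by
    rw [← μ.apply_symm_apply p, ← hφ₁, mul_smul, mul_smul, hφ₁, hφ₁]
  have hφ : ∀ g p, μ (g • p) = φ g • μ p := hφ₁
  have hsurj : Function.Surjective φ := fun h => by
    obtain ⟨g, hg⟩ := h2 h
    refine ⟨g, jacobiGroup_faithful fun p => ?_⟩
    change φ₀ g • p = h • p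
    rw [← hφ₀, hg]
  -- Swapping a pair modulo the group forces the isometry to interchange the arguments of a function
  -- that is not symmetric.
  have hF : ∀ p q, pairInvariant (μ q) (μ p) = pairInvariant p q := fun p q => by
    obtain ⟨g, hp, hq⟩ := h3 p q
    rw [← hp, ← hq, pairInvariant_smul]
  -- Points of the section z = 0 have mutual invariant 0, so their images share the same real
  -- coordinates.
  have hs : ∀ τ τ' : ℍ, lamCoord (μ (τ, 0)) = lamCoord (μ (τ', 0)) ∧
      muCoord (μ (τ, 0)) = muCoord (μ (τ', 0)) := fun τ τ' => by
    apply eq_of_pairInvariant_eq_zero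
    rw [hF]
    simp [pairInvariant, lamCoord, muCoord]
  let n : JacobiGroup := ⟨1, !![0, 1]⟩
  have hn : ∀ τ : ℍ, n • ((τ, 0) : ℍ × ℂ) = (τ, 1) := fun τ => by
    refine Prod.ext (UpperHalfPlane.ext ?_) ?_
    · rw [JacobiGroup.smul_fst]
      simp [n, JacobiGroup.factor]
    · rw [JacobiGroup.smul_snd]
      simp [n, JacobiGroup.factor]
  have hmat := mat_eq_one_of_surjective φ hsurj (n := n) rfl
  have hc : ∀ p, lamCoord (φ n • p) = lamCoord p + (φ n).vec 0 0 ∧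
      muCoord (φ n • p) = muCoord p + (φ n).vec 0 1 := fun p => by
    have h := coords_smul (φ n) p
    simpa [hmat] using h
  -- The points (τ, 1) are translates of (τ, 0), and the isometry turns this translation into
  -- another one, so their images also share their real coordinates. After the interchange, τ enters
  -- only through these.
  have hconst : ∀ τ τ' : ℍ, pairInvariant (τ, 1) (UpperHalfPlane.I, 0) =
      pairInvariant (τ', 1) (UpperHalfPlane.I, 0) := fun τ τ' => by
    rw [← hF (τ, 1), ← hF (τ', 1), ← hn τ, ← hn τ', hφ n, hφ n, pairInvariant, pairInvariant, (hc _).1, (hc _).1,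
      (hc _).2, (hc _).2, (hs τ τ').1, (hs τ τ').2]
  -- The invariant of (τ, 1) and (i, 0) is 1/y, which is 1 at i and 1/2 at 2i.
  have h := hconst UpperHalfPlane.I ⟨2 * Complex.I, by simp⟩
  have him : UpperHalfPlane.im ⟨2 * Complex.I, by simp⟩ = 2 := by
    rw [← UpperHalfPlane.coe_im]
    simp
  simp [pairInvariant, lamCoord, muCoord, him] at h

end MaassJacobi
end

open MaassJacobi
theorem theorem2p3 :
    invariantDiffOps =
      (Algebra.adjoin ℂ {opD, opPsi, opD₁, opD₂} : Set (Module.End ℂ SmoothFun)) ∧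
    opD * opPsi - opPsi * opD =
      2 * y ^ 2 * dy * (du ^ 2 - dv ^ 2) - 4 * y ^ 2 * dx * du * dv
        - 2 * (v * dv * opPsi + opPsi) ∧
    opD * opPsi - opPsi * opD ≠ 0 ∧
    (∃ A ∈ invariantDiffOps, ∃ B ∈ invariantDiffOps, A * B ≠ B * A) ∧
    ¬ IsWeaklySymmetric (𝓘(ℝ, ℂ).prod 𝓘(ℝ, ℂ)) JacobiGroup (ℍ × ℂ) := by
  refine ⟨invariantDiffOps_eq, opD_opPsi_commutator, opD_opPsi_commutator_ne_zero,
    ⟨opD, ?_, opPsi, ?_, ?_⟩, not_isWeaklySymmetric⟩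
  · rw [invariantDiffOps_eq]
    exact opD_mem_generated
  · rw [invariantDiffOps_eq]
    exact opPsi_mem_generated
  · intro h
    apply opD_opPsi_commutator_ne_zero
    rw [h]
    ext1 f
    exact sub_self _
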